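/- **Theorem (Zero-Order Empirical Distribution).** Let $\mathcal A$ be a finite alphabet, let $\mathcal M(\mathcal A)$ be the simplex of probability mass functions on $\mathcal A$ with its Euclidean topology and Borel $\sigma$-algebra, and let $\Pi$ be any Borel probability measure on $\mathcal M(\mathcal A)$. The LZ78 source with prior $\Pi$ is the following process $X_1,X_2,\dots$ with values in $\mathcal A$, generated together with node parameters $B_1,B_2,\dots$ in $\mathcal M(\mathcal A)$. Let $\Theta_0,\Theta_1,\dots$ be i.i.d. with law $\Pi$. Start with a tree that consists of a root only, the root being the current node. At each time $t\ge 1$: 1. if the current node has no parameter yet, assign to it the first $\Theta_j$ not used so far; let $B_t$ be the parameter of the current node; 2. given $(\Theta_j)_{j\ge 0}$ and $X_1,\dots,X_{t-1}$, draw $X_t$ from the probability mass function $B_t$; 3. if the current node has a child along the symbol $X_t$, that child becomes the current node; otherwise add this child to the tree as a new leaf and make the root the current node. Let $M_n=\frac1n\sum_{i=1}^n\delta_{B_i}$ be the empirical measure of the node parameters. Then, almost surely, $M_n$ converges weakly to $\Pi$ as $n\to\infty$. Moreover, for every measurable set $A\subseteq\mathcal M(\mathcal A)$, $M_n(A)\to\Pi(A)$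 almost surely as $n\to\infty$. -/

import Mathlib

open MeasureTheory ProbabilityTheory Filter Topology
open scoped NNReal ENNReal

namespace LZ78

/-- State of the incremental parser. A node of the prefix tree is the word read on the path from the
root to it, so the root is `[]` and the child of `z` along the symbol `a` is `z ++ [a]`. -/
structure State (𝒜 : Type*) where
  /-- the nodes of the current tree -/
  tree : Finset (List 𝒜)
  /-- the nodes that already carry a parameter, in the order in which the parameters were assigned:
  the `j`-th entry (counting from `0`) carries the `j`-th parameter `Θ_j` -/
  labelled : List (List 𝒜)
  /-- the current node -/
  current : List 𝒜

/-- Before the first symbol the tree consists of the root, which is the current node. -/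
def State.init (𝒜 : Type*) : State 𝒜 where
  tree := {[]}
  labelled := []
  current := []

/-- One time step, in which the symbol `a` is emitted from the current node: the current node
receives the next parameter if it has none yet; then one moves along `a` if that child exists, and
otherwise adds it as a new leaf and returns to the root. -/
def State.step {𝒜 : Type*} [DecidableEq 𝒜] (s : State 𝒜) (a : 𝒜) : State 𝒜 where
  tree := insert (s.current ++ [a]) s.tree
  labelled := if s.current ∈ s.labelled then s.labelled else s.labelled ++ [s.current]
  current := if s.current ++ [a] ∈ s.tree then s.current ++ [a] else []

/-- The state after reading the word `w`. -/
def stateAfter {𝒜 : Type*} [DecidableEq 𝒜] (w : List 𝒜) : State 𝒜 :=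
  w.foldl State.step (State.init 𝒜)

/-- After the symbols `w`, the index `j` of the parameter `Θ_j` of the current node. If the node is
not labelled yet, `List.idxOf` returns the length of the list, the index of the next unused
parameter, which is the one that this node is about to receive. -/
def paramIndex {𝒜 : Type*} [DecidableEq 𝒜] (w : List 𝒜) : ℕ :=
  (stateAfter w).labelled.idxOf (stateAfter w).current

/-- The process `B`: the parameter of the node that is current at each time. Time is counted from
`0`, so `nodeParam Θ X t` and `X t` are what is usually written `B_{t+1}` and `X_{t+1}`. -/
def nodeParam {𝒜 Ω M : Type*} [DecidableEq 𝒜] (Θ : ℕ → Ω → M) (X : ℕ → Ω → 𝒜)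
    (t : ℕ) (ω : Ω) : M :=
  Θ (paramIndex (List.ofFn fun s : Fin t => X s ω)) ω

/-- `X` is an LZ78 source with prior `μ`, driven by the parameters `Θ`: the `Θ j` are i.i.d. with law
`μ`, and given everything generated before (the parameters and the symbols `X 0, …, X (t - 1)`), the
symbol `X t` is drawn from the probability mass function attached to the current node. -/
structure IsSource {𝒜 : Type*} [Fintype 𝒜] [DecidableEq 𝒜] [MeasurableSpace 𝒜]
    (μ : ProbabilityMeasure (stdSimplex ℝ 𝒜))
    {Ω : Type*} [MeasurableSpace Ω] (P : Measure Ω)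
    (Θ : ℕ → Ω → stdSimplex ℝ 𝒜) (X : ℕ → Ω → 𝒜) : Prop where
  measurable_param : ∀ j, Measurable (Θ j)
  measurable_symbol : ∀ t, Measurable (X t)
  indep_param : iIndepFun Θ P
  law_param : ∀ j, P.map (Θ j) = (μ : Measure (stdSimplex ℝ 𝒜))
  cond_symbol : ∀ (t : ℕ) (a : 𝒜),
    P⟦X t ⁻¹' {a} | MeasurableSpace.comap
        (fun ω => ((fun j => Θ j ω), (fun s : Fin t => X s ω))) inferInstance⟧
      =ᵐ[P] fun ω => nodeParam Θ X t ω a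

/-- The empirical measure `(1 / n) ∑_{t < n} δ_{b t}` (the zero measure for `n = 0`). -/
noncomputable def empiricalMeasure {M : Type*} [MeasurableSpace M] (b : ℕ → M) (n : ℕ) :
    FiniteMeasure M :=
  (n : ℝ≥0)⁻¹ • ∑ t ∈ Finset.range n, (diracProba (b t)).toFiniteMeasure

/-! Existence of the source: a realization driven by independent uniform variables. -/

/-- The kernel that draws a symbol from a probability mass function. -/
noncomputable def symbolKernel {𝒜 : Type*} [Fintype 𝒜] [MeasurableSpace 𝒜] :
    Kernel (stdSimplex ℝ 𝒜) 𝒜 where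
  toFun θ := ∑ a, ENNReal.ofReal (θ a) • Measure.dirac a
  measurable' := by
    refine Measure.measurable_of_measurable_coe _ fun s hs => ?_
    simp only [Measure.coe_finsetSum, Finset.sum_apply, Measure.smul_apply, smul_eq_mul]
    refine Finset.measurable_sum _ fun a _ => ?_
    refine Measurable.mul_const ?_ _
    exact ENNReal.measurable_ofReal.comp ((measurable_pi_apply a).comp measurable_subtype_coe)

lemma symbolKernel_apply {𝒜 : Type*} [Fintype 𝒜] [MeasurableSpace 𝒜]
    (θ : stdSimplex ℝ 𝒜) :
    symbolKernel θ = ∑ a, ENNReal.ofReal (θ a) • Measure.dirac a := rfl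

instance instIsMarkovKernelSymbolKernel {𝒜 : Type*} [Fintype 𝒜] [MeasurableSpace 𝒜] :
    IsMarkovKernel (symbolKernel (𝒜 := 𝒜)) where
  isProbabilityMeasure θ := by
    constructor
    rw [symbolKernel_apply]
    simp only [Measure.coe_finsetSum, Finset.sum_apply, Measure.smul_apply, smul_eq_mul, measure_univ, mul_one]
    rw [← ENNReal.ofReal_sum_of_nonneg (f := fun a => θ a) (fun a _ => θ.2.1 a)]
    simp 

lemma symbolKernel_real {𝒜 : Type*} [Fintype 𝒜] [MeasurableSpace 𝒜]
    [MeasurableSingletonClass 𝒜] (θ : stdSimplex ℝ 𝒜) (a : 𝒜) : (symbolKernel θ).real {a} = θ a := by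
  rw [measureReal_def, symbolKernel_apply]
  simp only [Measure.coe_finsetSum, Finset.sum_apply, Measure.smul_apply, smul_eq_mul]
  rw [Finset.sum_eq_single a]
  · simp
  · intro b _ hb
    simp [hb]
  · simp

lemma measurable_prodMk_of {Ω A B : Type*} [MeasurableSpace A] [MeasurableSpace B] (m : MeasurableSpace Ω) {f : Ω → A}
    {g : Ω → B} (hf : Measurable[m] f) (hg : Measurable[m] g) :
    Measurable[m] (fun ω => (f ω, g ω)) := hf.prodMk hg

/-- Every prior has an LZ78 source. -/
theorem exists_isSource {𝒜 : Type*} [Fintype 𝒜] [DecidableEq 𝒜] [MeasurableSpace 𝒜]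
    [MeasurableSingletonClass 𝒜] (μ : ProbabilityMeasure (stdSimplex ℝ 𝒜)) :
    ∃ (P : Measure (ℕ ⊕ ℕ → unitInterval)) (_ : IsProbabilityMeasure P)
      (Θ : ℕ → (ℕ ⊕ ℕ → unitInterval) → stdSimplex ℝ 𝒜) (X : ℕ → (ℕ ⊕ ℕ → unitInterval) → 𝒜),
      IsSource μ P Θ X := by
  have hn : Nonempty (stdSimplex ℝ 𝒜) := by
    have := (inferInstance : NeZero (μ : Measure (stdSimplex ℝ 𝒜)))
    exact nonempty_of_isProbabilityMeasure (μ : Measure (stdSimplex ℝ 𝒜))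
  have hn' : Nonempty 𝒜 := by
    by_contra h
    rw [not_nonempty_iff] at h
    have := stdSimplex.sum_eq_one hn.some
    rw [Fintype.sum_empty] at this
    exact zero_ne_one this
  have : StandardBorelSpace (stdSimplex ℝ 𝒜) := (isClosed_stdSimplex ℝ 𝒜).measurableSet.standardBorel
  obtain ⟨G, hG, hGm⟩ := Measure.exists_measurable_map_eq (μ : Measure (stdSimplex ℝ 𝒜))
  obtain ⟨F, hF, hFm⟩ := Kernel.exists_measurable_map_eq_unitInterval (symbolKernel (𝒜 := 𝒜))
  let P : Measure (ℕ ⊕ ℕ → unitInterval) := Measure.infinitePi fun _ => (volume : Measure unitInterval)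
  let Θ : ℕ → (ℕ ⊕ ℕ → unitInterval) → stdSimplex ℝ 𝒜 := fun j ω => G (ω (.inl j))
  let hist : ℕ → (ℕ ⊕ ℕ → unitInterval) → List 𝒜 := fun t ω =>
    Nat.rec [] (fun t l => l ++ [F (Θ (paramIndex l) ω) (ω (.inr t))]) t
  let X : ℕ → (ℕ ⊕ ℕ → unitInterval) → 𝒜 := fun t ω => F (Θ (paramIndex (hist t ω)) ω) (ω (.inr t))
  have hhist : ∀ t ω, hist t ω = List.ofFn fun s : Fin t => X s ω := by
    intro t ω
    induction t with
    | zero => rfl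
    | succ t ih =>
      rw [List.ofFn_succ_last]
      change hist t ω ++ [X t ω] = _
      congr 1
  have hXB : ∀ t ω, X t ω = F (nodeParam Θ X t ω) (ω (.inr t)) := by
    intro t ω
    change F (Θ (paramIndex (hist t ω)) ω) (ω (.inr t)) = _
    rw [hhist]
    rfl
  -- the driving parameter as a function of the past
  let β : ∀ t, (ℕ → stdSimplex ℝ 𝒜) × (Fin t → 𝒜) → stdSimplex ℝ 𝒜 :=
    fun t v => v.1 (paramIndex (List.ofFn v.2))
  have hβ : ∀ t, Measurable (β t) := by
    intro t
    have h1 : Measurable fun p : (Fin t → 𝒜) × (ℕ → stdSimplex ℝ 𝒜) =>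
        p.2 (paramIndex (List.ofFn p.1)) :=
      measurable_from_prod_countable_right fun x =>
        (measurable_pi_apply (paramIndex (List.ofFn x)) :
          Measurable fun y : ℕ → stdSimplex ℝ 𝒜 => y (paramIndex (List.ofFn x)))
    exact h1.comp measurable_swap
  let V : ∀ t, (ℕ ⊕ ℕ → unitInterval) → (ℕ → stdSimplex ℝ 𝒜) × (Fin t → 𝒜) :=
    fun t ω => ((fun j => Θ j ω), (fun s : Fin t => X s ω))
  let S : ℕ → Set (ℕ ⊕ ℕ) := fun t => {i | ∀ s, i = .inr s → s < t}
  let m : ℕ → MeasurableSpace (ℕ ⊕ ℕ → unitInterval) := fun t =>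
    ⨆ i ∈ S t, MeasurableSpace.comap (fun ω : ℕ ⊕ ℕ → unitInterval => ω i) inferInstance
  have hcoord : ∀ t, ∀ i ∈ S t, Measurable[m t] (fun ω : ℕ ⊕ ℕ → unitInterval => ω i) := by
    intro t i hi
    rw [measurable_iff_comap_le]
    exact le_iSup₂_of_le i hi le_rfl
  have hmono : ∀ s t, s ≤ t → m s ≤ m t := by
    intro s t h
    exact biSup_mono fun i hi k hk => (hi k hk).trans_le h
  have hΘm : ∀ t j, Measurable[m t] (Θ j) := fun t j => hG.comp (hcoord t _ (by simp [S]))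
  have hXm : ∀ t, Measurable[m (t+1)] (X t) := by
    intro t
    induction t using Nat.strong_induction_on with
    | _ t ih =>
      have hV : Measurable[m (t+1)] (V t) := by
        refine measurable_prodMk_of (m (t+1)) (f := fun ω j => Θ j ω) (g := fun ω (s : Fin t) => X s ω) ?_ ?_
        · exact @measurable_pi_lambda _ _ _ (m (t+1)) _ _ fun j => hΘm _ j
        · exact @measurable_pi_lambda _ _ _ (m (t+1)) _ _ fun s =>
            (ih s s.2).mono (hmono _ _ (by omega)) le_rfl
      have h2 : X t = fun ω => (Function.uncurry F) (β t (V t ω), ω (.inr t)) := by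
        funext ω; exact hXB t ω
      rw [h2]
      exact hF.comp (measurable_prodMk_of (m (t+1)) (f := fun ω => β t (V t ω))
        (g := fun ω => ω (.inr t)) ((hβ t).comp hV) (hcoord _ _ (by simp [S])))
  have hVm : ∀ t, Measurable[m t] (V t) := by
    intro t
    refine measurable_prodMk_of (m t) (f := fun ω j => Θ j ω) (g := fun ω (s : Fin t) => X s ω) ?_ ?_
    · exact @measurable_pi_lambda _ _ _ (m t) _ _ fun j => hΘm _ j
    · exact @measurable_pi_lambda _ _ _ (m t) _ _ fun s =>
        (hXm s).mono (hmono _ _ (by omega)) le_rfl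
  have hle : ∀ t, m t ≤ MeasurableSpace.pi := by
    intro t
    refine iSup₂_le fun i _ => ?_
    exact (measurable_pi_apply i).comap_le
  have hind : iIndepFun (fun i (ω : ℕ ⊕ ℕ → unitInterval) => ω i) P :=
    iIndepFun_infinitePi (P := fun _ : ℕ ⊕ ℕ => (volume : Measure unitInterval)) (X := fun _ x => x)
      fun _ => measurable_id
  have hcoordlaw : ∀ i, P.map (fun ω : ℕ ⊕ ℕ → unitInterval => ω i) = volume := fun i =>
    Measure.infinitePi_map_eval (fun _ : ℕ ⊕ ℕ => (volume : Measure unitInterval)) i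
  have hVU : ∀ t, IndepFun (V t) (fun ω => ω (.inr t)) P := by
    intro t
    have h := indep_iSup_of_disjoint (fun i => (measurable_pi_apply i).comap_le) hind.iIndep
      (S := S t) (T := {.inr t}) (by simp [S])
    rw [IndepFun_iff_Indep]
    refine indep_of_indep_of_le_left (indep_of_indep_of_le_right h ?_) (hVm t).comap_le
    simp
  have hXmeas : ∀ t, Measurable (X t) := fun t => (hXm t).mono (hle _) le_rfl
  have hVmeas : ∀ t, Measurable (V t) := fun t => (hVm t).mono (hle _) le_rfl
  refine ⟨P, inferInstance, Θ, X, ⟨fun j => (hΘm 0 j).mono (hle 0) le_rfl, hXmeas, ?_, ?_, ?_⟩⟩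
  · exact (hind.precomp Sum.inl_injective).comp (fun _ => G) fun _ => hG
  · intro j
    rw [← hGm, ← hcoordlaw (.inl j), Measure.map_map hG (measurable_pi_apply (Sum.inl j))]
    rfl
  · intro t a
    have hk : condDistrib (X t) (V t) P =ᵐ[P.map (V t)] symbolKernel.comap (β t) (hβ t) := by
      refine condDistrib_ae_eq_of_measure_eq_compProd (V t) (hXmeas t).aemeasurable ?_
      have h1 := (indepFun_iff_map_prod_eq_prod_map_map (hVmeas t).aemeasurable
        (measurable_pi_apply _).aemeasurable).1 (hVU t)
      rw [hcoordlaw] at h1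
      have hφ : Measurable fun p : ((ℕ → stdSimplex ℝ 𝒜) × (Fin t → 𝒜)) × unitInterval =>
          (p.1, F (β t p.1) p.2) :=
        measurable_fst.prodMk (hF.comp (((hβ t).comp measurable_fst).prodMk measurable_snd))
      have h2 : (fun ω => (V t ω, X t ω)) =
          (fun p : ((ℕ → stdSimplex ℝ 𝒜) × (Fin t → 𝒜)) × unitInterval => (p.1, F (β t p.1) p.2)) ∘
            fun ω => (V t ω, ω (.inr t)) := by
        funext ω
        simp only [Function.comp]
        rw [hXB]
        rfl
      rw [h2, ← Measure.map_map hφ ((hVmeas t).prodMk (measurable_pi_apply _)), h1]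
      have : IsProbabilityMeasure (P.map (V t)) :=
        Measure.isProbabilityMeasure_map (hVmeas t).aemeasurable
      ext s hs
      rw [Measure.map_apply hφ hs, Measure.prod_apply (hφ hs), Measure.compProd_apply hs]
      refine lintegral_congr fun v => ?_
      rw [Kernel.comap_apply, ← hFm, Measure.map_apply (hF.of_uncurry_left)
        (measurable_prodMk_left hs)]
      rfl
    refine (condDistrib_ae_eq_condExp (hVmeas t) (hXmeas t) (measurableSet_singleton a)).symm.trans ?_
    filter_upwards [ae_of_ae_map (hVmeas t).aemeasurable hk] with ω hω
    rw [hω, Kernel.comap_apply, symbolKernel_real]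
    rfl

end LZ78

/-! The process is realised on a richer space: every potential node `z` has its own parameter,
i.i.d. with law `μ`, and every visit to `z` uses its own uniform variable. By
`IsSource.map_nodeParam_eq` the parameters met along the way have the same law there as in any
source, so almost sure convergence can be proved there.

The times before `n` are grouped by visit number: the sum of `f` over the current parameters equals
the sum over `m` of the sums over all nodes visited more than `m` times (`Follows.sum_node_eq`). Fix
`m` and list the nodes in the order in which they receive visit `m`. The order depends on the
parameters, but the event that `a` comes next, together with the set of its predecessors, does not
depend on the parameter of `a`. That parameter acts only on phrases that have already reached `a`;
it changes the run only strictly below `a`, where no node has more visits than `a` itself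
(`Follows.exists_same_frequent`). Hence the mean of a product of `g` over the first `v` listed nodes
is at most `(∫ g)^v`, as for i.i.d. parameters (`lintegral_walk_le`). For centred `f` bounded by
`1`, Hoeffding's lemma and Chernoff's bound make a sum above `ε v` in absolute value exponentially
unlikely in `v`.

Different `m` are dependent, so only first moments are used across them. An exceptional `m` costs at
most its number `d m` of nodes, and `d m ^ 2` is dominated by `excess`, whose mean is bounded
uniformly in `m`. If the root has `R` visits, Cauchy–Schwarz and a dyadic first moment argument
bound the total cost by `o(R log R)`. The alphabet is finite, so `R` phrases take time at least of
order `R log R` (`exists_phrase_rate`), and the cost is `o(n)`. -/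

namespace LZ78

/-! ### Deterministic dynamics of the parser -/

section Parsing

variable {𝒜 : Type*} [DecidableEq 𝒜]

/-- The state of the parser after the first `t` symbols of the sequence `x`. -/
def stateAt (x : ℕ → 𝒜) (t : ℕ) : State 𝒜 := stateAfter (List.ofFn fun s : Fin t => x s)

/-- The node that is current when the symbol `x t` is read. -/
def node (x : ℕ → 𝒜) (t : ℕ) : List 𝒜 := (stateAt x t).current

/-- The number of times before `t` at which the node `z` was current. -/
def visits (x : ℕ → 𝒜) (t : ℕ) (z : List 𝒜) : ℕ := Nat.count (fun s => node x s = z) t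

/-- The symbols of `x` are read off the table `D`: the `i`-th visit to `z` emits `D z i`. -/
def Follows (D : List 𝒜 → ℕ → 𝒜) (x : ℕ → 𝒜) : Prop :=
  ∀ t, x t = D (node x t) (visits x t (node x t))

lemma stateAt_zero (x : ℕ → 𝒜) : stateAt x 0 = State.init 𝒜 := rfl

lemma stateAt_succ (x : ℕ → 𝒜) (t : ℕ) : stateAt x (t + 1) = (stateAt x t).step (x t) := by
  unfold stateAt stateAfter
  rw [List.ofFn_succ_last, List.foldl_append]
  rfl

lemma node_zero (x : ℕ → 𝒜) : node x 0 = [] := rfl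

lemma tree_succ (x : ℕ → 𝒜) (t : ℕ) :
    (stateAt x (t + 1)).tree = insert (node x t ++ [x t]) (stateAt x t).tree := by
  rw [stateAt_succ]; rfl

lemma node_succ (x : ℕ → 𝒜) (t : ℕ) :
    node x (t + 1) =
      if node x t ++ [x t] ∈ (stateAt x t).tree then node x t ++ [x t] else [] := by
  rw [node, stateAt_succ]; rfl

lemma visits_zero (x : ℕ → 𝒜) (z : List 𝒜) : visits x 0 z = 0 := rfl

lemma visits_succ (x : ℕ → 𝒜) (t : ℕ) (z : List 𝒜) :
    visits x (t + 1) z = visits x t z + if node x t = z then 1 else 0 := by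
  simp [visits, Nat.count_succ]

lemma visits_mono (x : ℕ → 𝒜) (z : List 𝒜) : Monotone fun t => visits x t z :=
  Nat.count_monotone _

lemma stateAt_congr {x y : ℕ → 𝒜} {t : ℕ} (h : ∀ s < t, x s = y s) : stateAt x t = stateAt y t := by
  unfold stateAt
  congr 2
  funext s
  exact h s s.2

lemma node_congr {x y : ℕ → 𝒜} {t : ℕ} (h : ∀ s < t, x s = y s) : node x t = node y t := by
  rw [node, node, stateAt_congr h]

lemma visits_congr {x y : ℕ → 𝒜} {t : ℕ} (h : ∀ s < t, x s = y s) (z : List 𝒜) :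
    visits x t z = visits y t z := by
  induction t with
  | zero => rfl
  | succ t ih =>
    rw [visits_succ, visits_succ, ih fun s hs => h s (by omega),
      node_congr fun s hs => h s (by omega)]

/-! ### Size of the tree -/

lemma tree_mono (x : ℕ → 𝒜) : Monotone fun t => (stateAt x t).tree :=
  monotone_nat_of_le_succ fun t => by
    rw [tree_succ]; exact Finset.subset_insert _ _

lemma node_mem_tree (x : ℕ → 𝒜) (t : ℕ) : node x t ∈ (stateAt x t).tree := by
  have hroot : ∀ t, ([] : List 𝒜) ∈ (stateAt x t).tree := fun t =>
    tree_mono x (Nat.zero_le t) (by simp [stateAt_zero, State.init])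
  cases t with
  | zero => exact hroot 0
  | succ t =>
    rw [node_succ, tree_succ]
    split_ifs
    · simp
    · exact Finset.mem_insert_of_mem (hroot t)

lemma mem_tree_of_visits_ne_zero {x : ℕ → 𝒜} {t : ℕ} {z : List 𝒜} (h : visits x t z ≠ 0) :
    z ∈ (stateAt x t).tree := by
  induction t with
  | zero => simp [visits_zero] at h
  | succ t ih =>
    rw [visits_succ] at h
    split_ifs at h with hc
    · exact tree_mono x (Nat.le_succ t) (hc ▸ node_mem_tree x t)
    · exact tree_mono x (Nat.le_succ t) (ih h)

/-- The number of times up to and including `t` at which the root was current. -/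
def phrase (x : ℕ → 𝒜) (t : ℕ) : ℕ := visits x (t + 1) []

lemma phrase_eq (x : ℕ → 𝒜) (t : ℕ) :
    phrase x t = visits x t [] + if node x t = [] then 1 else 0 := visits_succ x t []

lemma phrase_succ (x : ℕ → 𝒜) (t : ℕ) :
    phrase x (t + 1) = phrase x t + if node x (t + 1) = [] then 1 else 0 := visits_succ x (t + 1) []

/-- A leaf is added exactly when the walk returns to the root. -/
lemma card_tree (x : ℕ → 𝒜) (t : ℕ) : (stateAt x t).tree.card = phrase x t := by
  induction t with
  | zero => rfl
  | succ t ih =>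
    rw [phrase_succ, tree_succ, node_succ]
    by_cases h : node x t ++ [x t] ∈ (stateAt x t).tree
    · simp [h, ih]
    · simp [h, ih]

/-- A phrase that ends by adding a leaf of depth `d` took `d` steps; the unfinished phrase has taken
as many steps as its current depth. -/
lemma sum_length_tree (x : ℕ → 𝒜) (t : ℕ) :
    ∑ z ∈ (stateAt x t).tree, z.length + (node x t).length = t := by
  induction t with
  | zero => simp [stateAt_zero, State.init, node_zero]
  | succ t ih =>
    rw [tree_succ, node_succ]
    by_cases h : node x t ++ [x t] ∈ (stateAt x t).tree
    · simp only [h, if_true, Finset.insert_eq_of_mem, List.length_append, List.length_singleton]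
      omega
    · rw [Finset.sum_insert h]
      simp only [h, if_false, List.length_append, List.length_singleton, List.length_nil]
      omega

/-- If the number of phrases stopped growing, the tree would be frozen, and its total depth plus the
depth of one of its nodes could not keep up with time. -/
lemma exists_phrase_gt (x : ℕ → 𝒜) (K : ℕ) : ∃ t, K < phrase x t := by
  induction K with
  | zero => exact ⟨0, by simp [phrase_eq, node_zero]⟩
  | succ K ih =>
    obtain ⟨t, ht⟩ := ih
    by_contra! hK
    have hmono : Monotone (phrase x) := fun a b h => visits_mono x [] (by omega)
    have htree : ∀ s ≥ t, (stateAt x s).tree = (stateAt x t).tree := by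
      intro s hs
      refine (Finset.eq_of_subset_of_card_le (tree_mono x hs) ?_).symm
      rw [card_tree, card_tree]
      exact (hK s).trans ht
    set S := ∑ z ∈ (stateAt x t).tree, z.length
    -- By this time total depth plus current depth must exceed `2 * S`, although each of them is at
    -- most `S`.
    have hs : t ≤ t + 2 * S + 1 := by omega
    have h1 := sum_length_tree x (t + 2 * S + 1)
    have h2 := node_mem_tree x (t + 2 * S + 1)
    rw [htree _ hs] at h1 h2
    have h3 := Finset.single_le_sum (f := fun z : List 𝒜 => z.length) (fun _ _ => Nat.zero_le _) h2
    change S + _ = _ at h1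
    omega

/-- Every phrase starts at the root. -/
lemma exists_phrase_start (x : ℕ → 𝒜) {K : ℕ} (hK : 0 < K) :
    ∃ t, phrase x t = K ∧ node x t = [] := by
  have hex : ∃ t, K ≤ phrase x t := (exists_phrase_gt x K).imp fun _ => le_of_lt
  classical
  obtain ⟨t, ht, hmin⟩ : ∃ t, K ≤ phrase x t ∧ ∀ s < t, phrase x s < K :=
    ⟨Nat.find hex, Nat.find_spec hex, fun s hs => not_le.1 (Nat.find_min hex hs)⟩
  refine ⟨t, ?_⟩
  cases t with
  | zero =>
    have : phrase x 0 = 1 := rfl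
    exact ⟨by omega, rfl⟩
  | succ t =>
    have h1 := hmin t (by omega)
    have h2 := phrase_succ x t
    split_ifs at h2 with h
    · exact ⟨by omega, h⟩
    · omega

/-! ### Visits to children -/

/-- The first emission of `b` from `y` creates the child, and each later one moves to it. The last
summand is the visit that has begun but is not yet counted by `visits`. -/
lemma Follows.count_eq {D : List 𝒜 → ℕ → 𝒜} {x : ℕ → 𝒜} (h : Follows D x) (t : ℕ) (y : List 𝒜)
    (b : 𝒜) :
    Nat.count (fun i => D y i = b) (visits x t y) =
      visits x t (y ++ [b]) + (if y ++ [b] ∈ (stateAt x t).tree then 1 else 0) +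
        if node x t = y ++ [b] then 1 else 0 := by
  induction t with
  | zero => simp [visits_zero, stateAt_zero, State.init, node_zero]
  | succ t ih =>
    have hx := h t
    rw [visits_succ, visits_succ, tree_succ, node_succ]
    by_cases hc : node x t = y
    · have hne : node x t ≠ y ++ [b] := by rw [hc]; simp
      rw [if_pos hc, Nat.count_succ, ih, if_neg hne]
      rw [hc] at hx ⊢
      rw [← hx]
      by_cases hb : x t = b
      · by_cases hm : y ++ [b] ∈ (stateAt x t).tree <;> simp [hb, hm]
      · have : y ++ [b] ≠ y ++ [x t] := by simpa using Ne.symm hb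
        have h2 : (if y ++ [x t] ∈ (stateAt x t).tree then y ++ [x t] else []) ≠ y ++ [b] := by
          split_ifs
          · exact this.symm
          · simp
        simp [hb, h2, Ne.symm hb]
    · have h1 : y ++ [b] ≠ node x t ++ [x t] := by
        intro he
        exact hc (List.append_inj_left' he rfl).symm
      have h2 : (if node x t ++ [x t] ∈ (stateAt x t).tree then node x t ++ [x t] else []) ≠
          y ++ [b] := by
        split_ifs
        · exact h1.symm
        · simp
      rw [if_neg hc, add_zero, ih, if_neg h2]
      simp only [Finset.mem_insert, h1, false_or]
      omega

lemma Follows.mem_tree_iff {D : List 𝒜 → ℕ → 𝒜} {x : ℕ → 𝒜} (h : Follows D x) (t : ℕ)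
    (y : List 𝒜) (b : 𝒜) :
    y ++ [b] ∈ (stateAt x t).tree ↔ Nat.count (fun i => D y i = b) (visits x t y) ≠ 0 := by
  have hnode : node x t = y ++ [b] → y ++ [b] ∈ (stateAt x t).tree := fun e => e ▸ node_mem_tree x t
  rw [h.count_eq]
  constructor
  · intro hm
    simp [hm]
  · intro h0
    by_contra hm
    have h1 : visits x t (y ++ [b]) = 0 := by
      by_contra h'
      exact hm (mem_tree_of_visits_ne_zero h')
    have h2 : node x t ≠ y ++ [b] := fun e => hm (hnode e)
    simp [hm, h1, h2] at h0

lemma Follows.visits_child_le {D : List 𝒜 → ℕ → 𝒜} {x : ℕ → 𝒜} (h : Follows D x) (t : ℕ)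
    (y : List 𝒜) (b : 𝒜) : visits x t (y ++ [b]) ≤ visits x t y := by
  have h1 := h.count_eq t y b
  have h2 : Nat.count (fun i => D y i = b) (visits x t y) ≤ visits x t y := Nat.count_le _
  omega

lemma Follows.visits_append_le {D : List 𝒜 → ℕ → 𝒜} {x : ℕ → 𝒜} (h : Follows D x) (t : ℕ)
    (y v : List 𝒜) : visits x t (y ++ v) ≤ visits x t y := by
  induction v using List.reverseRecOn with
  | nil => simp
  | append_singleton v b ih =>
    rw [← List.append_assoc]
    exact (h.visits_child_le t _ b).trans ih

/-! ### Comparison of two runs whose tables differ at a single node -/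

/-- Visits to the root are read off the phrase number; by `Follows.count_eq` those to a child are
determined by the visits to its parent and the table there. This descends to every node not strictly
below `a`, since the parent is then never `a`. The times `t` and `t'` may differ, because phrases
through `a` may have different lengths. -/
lemma Follows.visits_eq_of_eqOn {D D' : List 𝒜 → ℕ → 𝒜} {x x' : ℕ → 𝒜} (h : Follows D x)
    (h' : Follows D' x') {a : List 𝒜} (hD : ∀ y, y ≠ a → D y = D' y) {t t' : ℕ}
    (hn : node x t = node x' t') (hp : phrase x t = phrase x' t') (u : List 𝒜)
    (hu : a <+: u → u = a) : visits x t u = visits x' t' u := by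
  induction u using List.reverseRecOn with
  | nil =>
    rw [phrase_eq, phrase_eq, hn] at hp
    omega
  | append_singleton y b ih =>
    have hya : y ≠ a := by
      rintro rfl
      have := hu (List.prefix_append _ _)
      simp at this
    have hy : visits x t y = visits x' t' y := by
      refine ih fun hay => ?_
      have e := hu (hay.trans (List.prefix_append _ _))
      have l := hay.length_le
      rw [← e] at l
      simp at l
    have e1 := h.count_eq t y b
    have e2 := h'.count_eq t' y b
    have m1 := h.mem_tree_iff t y b
    have m2 := h'.mem_tree_iff t' y b
    rw [hy, hD y hya] at e1 m1
    rw [if_congr (m1.trans m2.symm) rfl rfl, hn] at e1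
    omega

lemma node_eq_append {x : ℕ → 𝒜} {t : ℕ} {y : List 𝒜} {b : 𝒜} (h : node x t = y ++ [b]) :
    ∃ s, t = s + 1 ∧ node x s = y ∧ x s = b ∧ y ++ [b] ∈ (stateAt x s).tree := by
  cases t with
  | zero => simp [node_zero] at h
  | succ s =>
    rw [node_succ] at h
    split_ifs at h with hm
    · have h1 := List.append_inj_left' h rfl
      have h2 := List.append_inj_right' h rfl
      simp only [List.cons.injEq, and_true] at h2
      exact ⟨s, rfl, h1, h2, h ▸ hm⟩
    · simp at h

/-- A phrase on its way to `a` reads only entries at proper prefixes of `a`, where the tables and,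
by `Follows.visits_eq_of_eqOn`, the visit counts agree. So the phrase with the same number in the
other run takes the same path. -/
lemma Follows.exists_same_node {D D' : List 𝒜 → ℕ → 𝒜} {x x' : ℕ → 𝒜} (h : Follows D x)
    (h' : Follows D' x') {a : List 𝒜} (hD : ∀ y, y ≠ a → D y = D' y) (u : List 𝒜) (hu : u <+: a)
    {t : ℕ} (ht : node x t = u) : ∃ t', node x' t' = u ∧ phrase x' t' = phrase x t := by
  induction u using List.reverseRecOn generalizing t with
  | nil =>
    obtain ⟨t', h1, h2⟩ := exists_phrase_start x' (K := phrase x t) (by rw [phrase_eq, ht]; simp)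
    exact ⟨t', h2, h1⟩
  | append_singleton y b ih =>
    obtain ⟨s, rfl, hs, hxs, hm⟩ := node_eq_append ht
    have hya : y ≠ a := by
      rintro rfl
      have := hu.length_le
      simp at this
    obtain ⟨s', h1, h2⟩ := ih ((List.prefix_append _ _).trans hu) hs
    have hv : visits x s y = visits x' s' y := by
      refine h.visits_eq_of_eqOn h' hD (hs.trans h1.symm) h2.symm y fun hay => ?_
      exact (hay.eq_of_length_le ((List.prefix_append _ _).trans hu).length_le).symm
    have hx' : x' s' = b := by
      rw [h' s', h1, ← hv, ← hD y hya, ← hxs, h s, hs]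
    have hm' : y ++ [b] ∈ (stateAt x' s').tree := by
      rw [h'.mem_tree_iff, ← hv, ← hD y hya, ← h.mem_tree_iff]
      exact hm
    have hn' : node x' (s' + 1) = y ++ [b] := by
      rw [node_succ, h1, hx', if_pos hm']
    refine ⟨s' + 1, hn', ?_⟩
    rw [phrase_succ, phrase_succ, hn', ht, h2]

/-! ### Nodes grouped by their number of visits -/

/-- The nodes that were current more than `m` times before `t`. -/
def frequent (x : ℕ → 𝒜) (m t : ℕ) : Finset (List 𝒜) :=
  (stateAt x t).tree.filter fun z => m < visits x t z

lemma mem_frequent {x : ℕ → 𝒜} {m t : ℕ} {z : List 𝒜} :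
    z ∈ frequent x m t ↔ m < visits x t z := by
  rw [frequent, Finset.mem_filter, and_iff_right_iff_imp]
  exact fun h => mem_tree_of_visits_ne_zero (by omega)

/-- The runs can differ in their visit counts only strictly below `a`, and a node there has at most
as many visits as `a`, that is at most `m`, so it is not counted as frequent in either run. -/
lemma Follows.exists_same_frequent {D D' : List 𝒜 → ℕ → 𝒜} {x x' : ℕ → 𝒜} (h : Follows D x)
    (h' : Follows D' x') {a : List 𝒜} (hD : ∀ y, y ≠ a → D y = D' y) {m t : ℕ}
    (ht : node x t = a) (hm : visits x t a = m) :
    ∃ t', node x' t' = a ∧ visits x' t' a = m ∧ frequent x' m t' = frequent x m t := by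
  obtain ⟨t', h1, h2⟩ := h.exists_same_node h' hD a (List.prefix_refl a) ht
  have hv := fun u hu => h.visits_eq_of_eqOn h' hD (ht.trans h1.symm) h2.symm u hu
  have hm' : visits x' t' a = m := by rw [← hv a fun _ => rfl, hm]
  refine ⟨t', h1, hm', ?_⟩
  ext u
  rw [mem_frequent, mem_frequent]
  by_cases hu : a <+: u
  · obtain ⟨v, rfl⟩ := hu
    have e1 := h.visits_append_le t a v
    have e2 := h'.visits_append_le t' a v
    omega
  · rw [hv u fun hau => absurd hau hu]

lemma frequent_congr {x y : ℕ → 𝒜} {t : ℕ} (h : ∀ s < t, x s = y s) (m : ℕ) :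
    frequent x m t = frequent y m t := by
  ext z
  rw [mem_frequent, mem_frequent, visits_congr h]

lemma frequent_zero (x : ℕ → 𝒜) (m : ℕ) : frequent x m 0 = ∅ := by
  ext z
  simp [mem_frequent, visits_zero]

lemma frequent_succ_of_eq {x : ℕ → 𝒜} {m t : ℕ} (h : visits x t (node x t) = m) :
    frequent x m (t + 1) = insert (node x t) (frequent x m t) := by
  ext z
  rw [Finset.mem_insert, mem_frequent, mem_frequent, visits_succ]
  by_cases hz : node x t = z
  · subst hz
    simp [h]
  · simp [hz, Ne.symm hz]

lemma node_notMem_frequent {x : ℕ → 𝒜} {m t : ℕ} (h : visits x t (node x t) = m) :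
    node x t ∉ frequent x m t := by
  simp [mem_frequent, h]

lemma frequent_succ_of_ne {x : ℕ → 𝒜} {m t : ℕ} (h : visits x t (node x t) ≠ m) :
    frequent x m (t + 1) = frequent x m t := by
  ext z
  rw [mem_frequent, mem_frequent, visits_succ]
  by_cases hz : node x t = z
  · subst hz
    simp only [if_true]
    omega
  · simp [hz]

lemma frequent_mono (x : ℕ → 𝒜) (m : ℕ) : Monotone (frequent x m) := by
  intro s t h z
  rw [mem_frequent, mem_frequent]
  exact fun hz => hz.trans_le (visits_mono x z h)

/-- A nonempty set of frequent nodes arises by adding the current node to such a set. -/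
lemma exists_frequent_eq_insert {x : ℕ → 𝒜} {m t : ℕ} (h : (frequent x m t).card ≠ 0) :
    ∃ s, visits x s (node x s) = m ∧ frequent x m t = insert (node x s) (frequent x m s) := by
  induction t with
  | zero => simp [frequent_zero] at h
  | succ t ih =>
    by_cases hm : visits x t (node x t) = m
    · exact ⟨t, hm, frequent_succ_of_eq hm⟩
    · rw [frequent_succ_of_ne hm] at h ⊢
      exact ih h

/-- There is at most one time of an `m`-th visit at which `v` nodes are `m`-frequent. -/
lemma eq_of_card_frequent_eq {x : ℕ → 𝒜} {m s t : ℕ} (hs : visits x s (node x s) = m)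
    (ht : visits x t (node x t) = m) (h : (frequent x m s).card = (frequent x m t).card) :
    s = t := by
  have key : ∀ s t, visits x s (node x s) = m → s < t →
      (frequent x m s).card < (frequent x m t).card := by
    intro s t hs hst
    refine lt_of_lt_of_le ?_ (Finset.card_le_card (frequent_mono x m (Nat.succ_le_of_lt hst)))
    rw [frequent_succ_of_eq hs, Finset.card_insert_of_notMem (node_notMem_frequent hs)]
    omega
  rcases lt_trichotomy s t with hlt | heq | hgt
  · exact absurd h (key s t hs hlt).ne
  · exact heq
  · exact absurd h.symm (key t s ht hgt).ne

/-- Summation along the current nodes, grouped by the number of the visit. -/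
lemma Follows.sum_node_eq {D : List 𝒜 → ℕ → 𝒜} {x : ℕ → 𝒜} (h : Follows D x) {M : Type*}
    [AddCommMonoid M] (g : List 𝒜 → M) (n : ℕ) {R : ℕ} (hR : visits x n [] ≤ R) :
    ∑ t ∈ Finset.range n, g (node x t) = ∑ m ∈ Finset.range R, ∑ z ∈ frequent x m n, g z := by
  induction n with
  | zero => simp [frequent_zero]
  | succ n ih =>
    rw [Finset.sum_range_succ, ih ((visits_mono x [] (Nat.le_succ n)).trans hR)]
    -- No node is visited more often than the root, so the visit number of the new step is among
    -- those summed over.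
    have hlt : visits x n (node x n) < R := by
      have h1 := h.visits_append_le (n + 1) [] (node x n)
      have h2 := visits_succ x n (node x n)
      simp at h1 h2
      omega
    rw [← Finset.sum_erase_add _ _ (Finset.mem_range.2 hlt),
      ← Finset.sum_erase_add (Finset.range R) _ (Finset.mem_range.2 hlt),
      frequent_succ_of_eq rfl, Finset.sum_insert (node_notMem_frequent rfl), add_assoc,
      add_comm (g _)]
    congr 1
    refine Finset.sum_congr rfl fun m hm => ?_
    rw [frequent_succ_of_ne (Finset.ne_of_mem_erase hm).symm]

/-! ### The run of a table -/

/-- The first `t` symbols of the run of the table `D`. -/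
def runPrefix (D : List 𝒜 → ℕ → 𝒜) : ℕ → List 𝒜
  | 0 => []
  | t + 1 => runPrefix D t ++ [D (stateAfter (runPrefix D t)).current
      (Nat.count (fun s => (stateAfter ((runPrefix D t).take s)).current =
        (stateAfter (runPrefix D t)).current) t)]

/-- The run of the table `D`: the sequence in which the `i`-th visit to `z` emits `D z i`. -/
def run (D : List 𝒜 → ℕ → 𝒜) (t : ℕ) : 𝒜 :=
  D (stateAfter (runPrefix D t)).current
      (Nat.count (fun s => (stateAfter ((runPrefix D t).take s)).current =
        (stateAfter (runPrefix D t)).current) t)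

lemma runPrefix_eq (D : List 𝒜 → ℕ → 𝒜) (t : ℕ) :
    runPrefix D t = List.ofFn fun s : Fin t => run D s := by
  induction t with
  | zero => rfl
  | succ t ih =>
    rw [List.ofFn_succ_last]
    change runPrefix D t ++ [run D t] = _
    rw [ih]
    rfl

lemma take_ofFn_seq {α : Type*} (x : ℕ → α) {s t : ℕ} (h : s ≤ t) :
    (List.ofFn fun i : Fin t => x i).take s = List.ofFn fun i : Fin s => x i := by
  apply List.ext_getElem
  · simp [h]
  · intro i h1 h2
    simp

lemma follows_run (D : List 𝒜 → ℕ → 𝒜) : Follows D (run D) := by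
  intro t
  have h1 : (stateAfter (runPrefix D t)).current = node (run D) t := by
    rw [runPrefix_eq]; rfl
  rw [run, h1, visits, Nat.count_eq_card_filter_range, Nat.count_eq_card_filter_range]
  congr 2
  refine Finset.filter_congr fun s hs => ?_
  rw [runPrefix_eq, take_ofFn_seq _ (Finset.mem_range.1 hs).le]
  rfl

/-- The run of `D` starts with the symbols `w` if and only if `D` has the corresponding entries. -/
lemma run_eq_iff (D : List 𝒜 → ℕ → 𝒜) (w : ℕ → 𝒜) (n : ℕ) :
    (∀ t < n, run D t = w t) ↔ ∀ t < n, D (node w t) (visits w t (node w t)) = w t := by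
  induction n with
  | zero => simp
  | succ n ih =>
    rw [Nat.forall_lt_succ_right, Nat.forall_lt_succ_right, ← ih, and_congr_right_iff]
    intro hn
    rw [follows_run D n, node_congr hn, visits_congr hn]

/-- No cell of the table is read twice; this makes the probability of a word factorise over its
symbols. -/
lemma node_visits_injective (x : ℕ → 𝒜) :
    Function.Injective fun t => (node x t, visits x t (node x t)) := by
  have key : ∀ s t, s < t → (node x s, visits x s (node x s)) ≠ (node x t, visits x t (node x t)) := by
    intro s t hst he
    rw [Prod.mk.injEq] at he
    have h1 := visits_succ x s (node x s)
    have h2 := visits_mono x (node x s) (Nat.succ_le_of_lt hst)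
    rw [← he.1] at he
    simp at h1 h2 he
    omega
  intro s t he
  rcases lt_trichotomy s t with h | h | h
  · exact absurd he (key s t h)
  · exact h
  · exact absurd he.symm (key t s h)

/-! ### Labels -/

lemma stateAt_labelled_succ (x : ℕ → 𝒜) (t : ℕ) :
    (stateAt x (t + 1)).labelled =
      if node x t ∈ (stateAt x t).labelled then (stateAt x t).labelled
      else (stateAt x t).labelled ++ [node x t] := by
  rw [stateAt_succ]; rfl

lemma labelled_nodup (x : ℕ → 𝒜) (t : ℕ) : (stateAt x t).labelled.Nodup := by
  induction t with
  | zero => simp [stateAt_zero, State.init]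
  | succ t ih =>
    rw [stateAt_labelled_succ]
    split_ifs with h
    · exact ih
    · rw [List.nodup_append]
      refine ⟨ih, List.nodup_singleton _, ?_⟩
      intro a ha b hb
      rw [List.mem_singleton] at hb
      rintro rfl
      exact h (hb ▸ ha)

lemma labelled_prefix (x : ℕ → 𝒜) {s t : ℕ} (h : s ≤ t) :
    (stateAt x s).labelled <+: (stateAt x t).labelled := by
  induction h with
  | refl => exact List.prefix_refl _
  | step _ ih =>
    refine ih.trans ?_
    rw [stateAt_labelled_succ]
    split_ifs
    · exact List.prefix_refl _
    · exact List.prefix_append _ _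

/-- The label of the current node is its position in any later list of labelled nodes. -/
lemma paramIndex_eq_idxOf (x : ℕ → 𝒜) {s t : ℕ} (h : s < t) :
    node x s ∈ (stateAt x t).labelled ∧
      paramIndex (List.ofFn fun i : Fin s => x i) = (stateAt x t).labelled.idxOf (node x s) := by
  obtain ⟨l, hl⟩ := labelled_prefix x (Nat.succ_le_of_lt h)
  have h1 : node x s ∈ (stateAt x (s + 1)).labelled := by
    rw [stateAt_labelled_succ]
    split_ifs with hm
    · exact hm
    · simp
  refine ⟨hl ▸ List.mem_append_left _ h1, ?_⟩
  rw [← hl, Nat.succ_eq_add_one, List.idxOf_append_of_mem h1, stateAt_labelled_succ]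
  change (stateAt x s).labelled.idxOf (node x s) = _
  split_ifs with hm
  · rfl
  · rw [List.idxOf_append_of_notMem hm, List.idxOf_of_notMem hm]
    simp

end Parsing

/-! ### Independence of a coordinate, and measurability through a discrete history -/

/-- In a product of identical probability measures, a function that does not depend on the
coordinate `a` is uncorrelated with every function of that coordinate. -/
lemma lintegral_infinitePi_mul_of_update {ι E : Type*} [DecidableEq ι] [MeasurableSpace E]
    (μ : Measure E) [IsProbabilityMeasure μ] (a : ι) {h : (ι → E) → ℝ≥0∞} (hm : Measurable h)
    (hinv : ∀ θ x, h (Function.update θ a x) = h θ) {g : E → ℝ≥0∞} (hg : Measurable g) :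
    ∫⁻ θ, h θ * g (θ a) ∂Measure.infinitePi (fun _ : ι => μ) =
      (∫⁻ θ, h θ ∂Measure.infinitePi (fun _ : ι => μ)) * ∫⁻ x, g x ∂μ := by
  have hne : Nonempty E := nonempty_of_isProbabilityMeasure μ
  obtain ⟨x₀⟩ := hne
  have hind : iIndepFun (fun i (ω : ι → E) => ω i) (Measure.infinitePi fun _ : ι => μ) :=
    iIndepFun_infinitePi (P := fun _ : ι => μ) (X := fun _ x => x) fun _ => measurable_id
  have h1 := indep_iSup_of_disjoint (fun i => (measurable_pi_apply i).comap_le) hind.iIndep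
      (S := {a}ᶜ) (T := {a}) disjoint_compl_left
  have hh : Measurable[⨆ i ∈ ({a}ᶜ : Set ι),
      MeasurableSpace.comap (fun ω : ι → E => ω i) inferInstance] h := by
    -- Resetting coordinate `a` to a constant exhibits `h` as a function of the other coordinates
    -- only.
    have e : h = h ∘ fun θ => Function.update θ a x₀ := by
      funext θ; exact (hinv θ x₀).symm
    rw [e]
    refine hm.comp ?_
    refine @measurable_pi_lambda _ _ _ (_) _ _ fun i => ?_
    by_cases hi : i = a
    · subst hi
      simp only [Function.update_self]
      exact @measurable_const _ _ _ (_) _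
    · simp only [Function.update_of_ne hi]
      rw [measurable_iff_comap_le]
      exact le_iSup₂_of_le i hi le_rfl
  have hga : Measurable[⨆ i ∈ ({a} : Set ι),
      MeasurableSpace.comap (fun ω : ι → E => ω i) inferInstance] fun θ : ι → E => g (θ a) := by
    refine hg.comp ?_
    rw [measurable_iff_comap_le]
    exact le_iSup₂_of_le a rfl le_rfl
  rw [lintegral_mul_eq_lintegral_mul_lintegral_of_independent_measurableSpace
    (iSup₂_le fun i _ => (measurable_pi_apply i).comap_le)
    (iSup₂_le fun i _ => (measurable_pi_apply i).comap_le) h1 hh hga]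
  congr 1
  rw [← lintegral_map hg (measurable_pi_apply a), Measure.infinitePi_map_eval (fun _ : ι => μ) a]

/-- The sequence that starts with `w`. -/
noncomputable def extendSeq {α : Type*} [Nonempty α] {t : ℕ} (w : Fin t → α) (s : ℕ) : α :=
  if h : s < t then w ⟨s, h⟩ else Classical.arbitrary α

lemma extendSeq_eq {α : Type*} [Nonempty α] {t : ℕ} (x : ℕ → α) {s : ℕ} (h : s < t) :
    extendSeq (fun i : Fin t => x i) s = x s := by
  simp [extendSeq, h]

/-- Only the first `t` symbols matter, and they take countably many values, so measurability can be
checked with the symbols frozen. -/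
lemma measurable_of_history {α Ω β : Type*} [Countable α] [Nonempty α] [MeasurableSpace α]
    [MeasurableSingletonClass α] [MeasurableSpace Ω] [MeasurableSpace β] {Ψ : (ℕ → α) → Ω → β}
    (hΨ : ∀ x, Measurable (Ψ x)) {t : ℕ} (hc : ∀ x y, (∀ s < t, x s = y s) → Ψ x = Ψ y)
    {X : Ω → ℕ → α} (hX : ∀ s < t, Measurable fun ω => X ω s) : Measurable fun ω => Ψ (X ω) ω := by
  have h1 : Measurable fun p : (Fin t → α) × Ω => Ψ (extendSeq p.1) p.2 :=
    measurable_from_prod_countable_right fun w => hΨ (extendSeq w)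
  have h2 : Measurable fun ω => ((fun s : Fin t => X ω s), ω) :=
    (measurable_pi_lambda _ fun s : Fin t => hX s s.2).prodMk measurable_id
  have e : (fun ω => Ψ (X ω) ω) = (fun p : (Fin t → α) × Ω => Ψ (extendSeq p.1) p.2) ∘
      fun ω => ((fun s : Fin t => X ω s), ω) := by
    funext ω
    exact congrFun (hc _ _ fun s hs => (extendSeq_eq (X ω) hs).symm) ω
  rw [e]
  exact h1.comp h2

/-- A parameter for each node and a uniform variable for each visit to each node. -/
abbrev Sample (𝒜 M : Type*) := (List 𝒜 × ℕ → unitInterval) × (List 𝒜 → M)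

lemma measurable_prod_params {𝒜 M : Type*} [MeasurableSpace M] (g : M → ℝ≥0∞)
    (hg : Measurable g) (s : Finset (List 𝒜)) :
    Measurable fun ω : Sample 𝒜 M => ∏ z ∈ s, g (ω.2 z) :=
  Finset.measurable_prod _ fun z _ => hg.comp ((measurable_pi_apply z).comp measurable_snd)

/-! ### Exponential moments in the sampled process -/

section Model

variable {𝒜 M : Type*} [DecidableEq 𝒜]

/-- The table of symbols that `F` generates from a sample. -/
def table (F : M → unitInterval → 𝒜) (ω : Sample 𝒜 M) : List 𝒜 → ℕ → 𝒜 :=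
  fun z i => F (ω.2 z) (ω.1 (z, i))

/-- The symbols generated from a sample. -/
def symbols (F : M → unitInterval → 𝒜) (ω : Sample 𝒜 M) : ℕ → 𝒜 := run (table F ω)

lemma follows_symbols (F : M → unitInterval → 𝒜) (ω : Sample 𝒜 M) :
    Follows (table F ω) (symbols F ω) := follows_run _

/-- The product of `g` over the parameters of the first `v` nodes that are visited for the `m`-th
time (zero if there are fewer such nodes). -/
noncomputable def walk (F : M → unitInterval → 𝒜) (g : M → ℝ≥0∞) (m v : ℕ) (ω : Sample 𝒜 M) :
    ℝ≥0∞ :=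
  ⨆ n, if (frequent (symbols F ω) m n).card = v then
    ∏ z ∈ frequent (symbols F ω) m n, g (ω.2 z) else 0

/-- The part of `walk` on which the next node to be visited for the `m`-th time is `a`. -/
noncomputable def walkTo (F : M → unitInterval → 𝒜) (g : M → ℝ≥0∞) (m v : ℕ) (a : List 𝒜)
    (ω : Sample 𝒜 M) : ℝ≥0∞ :=
  ⨆ n, if node (symbols F ω) n = a ∧ visits (symbols F ω) n a = m ∧
      (frequent (symbols F ω) m n).card = v then
    ∏ z ∈ frequent (symbols F ω) m n, g (ω.2 z) else 0

/-- By `Follows.exists_same_frequent` the visit to `a` occurs after changing the parameter of `a`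
too, with the same predecessors. Only its time may change, which the supremum over `n` absorbs; `a`
itself is not in the product. -/
lemma walkTo_le_of_eqOn (F : M → unitInterval → 𝒜) (g : M → ℝ≥0∞) (m v : ℕ) (a : List 𝒜)
    {U : List 𝒜 × ℕ → unitInterval} {θ θ' : List 𝒜 → M} (h : ∀ z, z ≠ a → θ z = θ' z) :
    walkTo F g m v a (U, θ) ≤ walkTo F g m v a (U, θ') := by
  refine iSup_le fun n => ?_
  split_ifs with hn
  · obtain ⟨h1, h2, h3⟩ := hn
    obtain ⟨n', e1, e2, e3⟩ := (follows_symbols F (U, θ)).exists_same_frequent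
      (follows_symbols F (U, θ')) (a := a) (fun y hy => by
        funext i; simp [table, h y hy]) h1 h2
    refine le_iSup_of_le n' ?_
    rw [if_pos ⟨e1, e2, e3 ▸ h3⟩, e3]
    refine (Finset.prod_congr rfl fun z hz => ?_).le
    have hza : z ≠ a := by
      rintro rfl
      rw [mem_frequent] at hz
      omega
    simp [h z hza]
  · exact zero_le

lemma walkTo_update (F : M → unitInterval → 𝒜) (g : M → ℝ≥0∞) (m v : ℕ) (a : List 𝒜)
    (U : List 𝒜 × ℕ → unitInterval) (θ : List 𝒜 → M) (x : M) :
    walkTo F g m v a (U, Function.update θ a x) = walkTo F g m v a (U, θ) :=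
  le_antisymm (walkTo_le_of_eqOn F g m v a fun _ hz => Function.update_of_ne hz x θ)
    (walkTo_le_of_eqOn F g m v a fun _ hz => (Function.update_of_ne hz x θ).symm)

lemma walk_zero_le (F : M → unitInterval → 𝒜) (g : M → ℝ≥0∞) (m : ℕ) (ω : Sample 𝒜 M) :
    walk F g m 0 ω ≤ 1 := by
  refine iSup_le fun n => ?_
  split_ifs with h
  · rw [Finset.card_eq_zero.1 h, Finset.prod_empty]
  · exact zero_le_one

lemma walk_succ_le (F : M → unitInterval → 𝒜) (g : M → ℝ≥0∞) (m v : ℕ) (ω : Sample 𝒜 M) :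
    walk F g m (v + 1) ω ≤ ∑' a, walkTo F g m v a ω * g (ω.2 a) := by
  refine iSup_le fun n => ?_
  split_ifs with h
  · obtain ⟨s, hs, he⟩ := exists_frequent_eq_insert (x := symbols F ω) (m := m) (t := n) (by omega)
    refine le_trans ?_ (ENNReal.le_tsum (node (symbols F ω) s))
    have hc : (frequent (symbols F ω) m s).card = v := by
      rw [he, Finset.card_insert_of_notMem (node_notMem_frequent hs)] at h
      omega
    rw [he, Finset.prod_insert (node_notMem_frequent hs), mul_comm]
    gcongr
    refine le_iSup_of_le s ?_
    rw [if_pos ⟨rfl, hs, hc⟩]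
  · exact zero_le

/-- Every visit number `m` enlarges the frequent set, so it happens at most once at size `v`, and at
most one `a` contributes. None does if no further node ever gets that visit, hence the inequality.
-/
lemma tsum_walkTo_le (F : M → unitInterval → 𝒜) (g : M → ℝ≥0∞) (m v : ℕ) (ω : Sample 𝒜 M) :
    ∑' a, walkTo F g m v a ω ≤ walk F g m v ω := by
  have hle : ∀ a, walkTo F g m v a ω ≤ walk F g m v ω := by
    intro a
    refine iSup_mono fun n => ?_
    split_ifs with h1 h2 h2
    · exact le_rfl
    · exact absurd h1.2.2 h2
    · exact zero_le
    · exact le_rfl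
  by_cases hex : ∃ n, visits (symbols F ω) n (node (symbols F ω) n) = m ∧
      (frequent (symbols F ω) m n).card = v
  · obtain ⟨n, h1, h2⟩ := hex
    rw [tsum_eq_single (node (symbols F ω) n)]
    · exact hle _
    · intro a ha
      refine ENNReal.iSup_eq_zero.2 fun n' => if_neg ?_
      rintro ⟨rfl, h3, h4⟩
      exact ha (by rw [eq_of_card_frequent_eq h3 h1 (h4.trans h2.symm)])
  · have : ∀ a, walkTo F g m v a ω = 0 := fun a =>
      ENNReal.iSup_eq_zero.2 fun n => if_neg fun ⟨e1, e2, e3⟩ => hex ⟨n, e1 ▸ e2, e3⟩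
    simp [this]

variable [MeasurableSpace M]

/-- The law of a sample: everything is independent, with law `μ` for the parameters. -/
noncomputable def sampleLaw (𝒜 : Type*) (μ : Measure M) [IsProbabilityMeasure μ] :
    Measure (Sample 𝒜 M) :=
  (Measure.infinitePi fun _ => volume).prod (Measure.infinitePi fun _ => μ)

instance (μ : Measure M) [IsProbabilityMeasure μ] : IsProbabilityMeasure (sampleLaw 𝒜 μ) := by
  unfold sampleLaw; infer_instance

variable [Countable 𝒜] [Nonempty 𝒜] [MeasurableSpace 𝒜] [MeasurableSingletonClass 𝒜]

lemma measurable_symbols {F : M → unitInterval → 𝒜} (hF : Measurable (Function.uncurry F)) (t : ℕ) :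
    Measurable fun ω => symbols F ω t := by
  induction t using Nat.strong_induction_on with
  | _ t ih =>
    have h := measurable_of_history (X := symbols F) (t := t)
      (Ψ := fun x ω => table F ω (node x t) (visits x t (node x t))) ?_ ?_ ih
    · convert h using 2 with ω
      exact follows_symbols F ω t
    · intro x
      have h1 : Measurable fun ω : Sample 𝒜 M => (ω.2 (node x t), ω.1 (node x t, visits x t (node x t))) :=
        ((measurable_pi_apply (node x t)).comp measurable_snd).prodMk
          ((measurable_pi_apply (node x t, visits x t (node x t))).comp measurable_fst)
      exact hF.comp h1
    · intro x y hxy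
      simp only [node_congr hxy, visits_congr hxy]

lemma measurable_walk {F : M → unitInterval → 𝒜} (hF : Measurable (Function.uncurry F))
    {g : M → ℝ≥0∞} (hg : Measurable g) (m v : ℕ) : Measurable (walk F g m v) := by
  refine Measurable.iSup fun n => measurable_of_history (X := symbols F) (t := n)
    (Ψ := fun x ω => if (frequent x m n).card = v then ∏ z ∈ frequent x m n, g (ω.2 z) else 0)
    ?_ ?_ fun s _ => measurable_symbols hF s
  · intro x
    split_ifs
    · exact measurable_prod_params g hg _
    · exact measurable_const
  · intro x y hxy
    simp only [frequent_congr hxy]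

lemma measurable_walkTo {F : M → unitInterval → 𝒜} (hF : Measurable (Function.uncurry F))
    {g : M → ℝ≥0∞} (hg : Measurable g) (m v : ℕ) (a : List 𝒜) : Measurable (walkTo F g m v a) := by
  refine Measurable.iSup fun n => measurable_of_history (X := symbols F) (t := n)
    (Ψ := fun x ω => if node x n = a ∧ visits x n a = m ∧ (frequent x m n).card = v then
      ∏ z ∈ frequent x m n, g (ω.2 z) else 0) ?_ ?_ fun s _ => measurable_symbols hF s
  · intro x
    split_ifs
    · exact measurable_prod_params g hg _
    · exact measurable_const
  · intro x y hxy
    simp only [frequent_congr hxy, node_congr hxy, visits_congr hxy]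

/-- A supermartingale argument in `v`: with the uniform variables fixed, `walkTo` does not involve
the parameter of the node `a` about to be added, so the new factor integrates to `∫ g` independently
of the past. -/
lemma lintegral_walk_le {F : M → unitInterval → 𝒜} (hF : Measurable (Function.uncurry F))
    {g : M → ℝ≥0∞} (hg : Measurable g) (μ : Measure M) [IsProbabilityMeasure μ] (m v : ℕ) :
    ∫⁻ ω, walk F g m v ω ∂sampleLaw 𝒜 μ ≤ (∫⁻ x, g x ∂μ) ^ v := by
  induction v with
  | zero =>
    refine (lintegral_mono fun ω => walk_zero_le F g m ω).trans ?_
    simp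
  | succ v ih =>
    have hmul : ∀ a : List 𝒜, Measurable fun ω : Sample 𝒜 M => walkTo F g m v a ω * g (ω.2 a) :=
      fun a => (measurable_walkTo hF hg m v a).mul
        (hg.comp ((measurable_pi_apply a).comp measurable_snd))
    have hsite : ∀ a : List 𝒜, ∫⁻ ω, walkTo F g m v a ω * g (ω.2 a) ∂sampleLaw 𝒜 μ =
        (∫⁻ ω, walkTo F g m v a ω ∂sampleLaw 𝒜 μ) * ∫⁻ x, g x ∂μ := by
      intro a
      have hm := measurable_walkTo hF hg m v a
      unfold sampleLaw
      rw [lintegral_prod _ (hmul a).aemeasurable, lintegral_prod _ hm.aemeasurable,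
        ← lintegral_mul_const _ (hm.lintegral_prod_right')]
      refine lintegral_congr fun U => ?_
      exact lintegral_infinitePi_mul_of_update μ a (hm.comp measurable_prodMk_left)
        (fun θ x => walkTo_update F g m v a U θ x) hg
    calc ∫⁻ ω, walk F g m (v + 1) ω ∂sampleLaw 𝒜 μ
        ≤ ∫⁻ ω, ∑' a, walkTo F g m v a ω * g (ω.2 a) ∂sampleLaw 𝒜 μ :=
          lintegral_mono fun ω => walk_succ_le F g m v ω
      _ = ∑' a, (∫⁻ ω, walkTo F g m v a ω ∂sampleLaw 𝒜 μ) * ∫⁻ x, g x ∂μ := by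
          rw [lintegral_tsum fun a => (hmul a).aemeasurable]
          exact tsum_congr hsite
      _ = (∫⁻ ω, ∑' a, walkTo F g m v a ω ∂sampleLaw 𝒜 μ) * ∫⁻ x, g x ∂μ := by
          rw [ENNReal.tsum_mul_right,
            lintegral_tsum fun a => (measurable_walkTo hF hg m v a).aemeasurable]
      _ ≤ (∫⁻ x, g x ∂μ) ^ (v + 1) := by
          rw [pow_succ]
          gcongr
          exact (lintegral_mono fun ω => tsum_walkTo_le F g m v ω).trans ih

end Model

/-! ### Growth of the tree against time, and dyadic averages -/

lemma card_le_of_length_lt {α : Type*} [Fintype α] {S : Finset (List α)} {L : ℕ}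
    (h : ∀ z ∈ S, z.length < L) : S.card ≤ (Fintype.card α + 1) ^ L := by
  classical
  have hinj : Set.InjOn (fun (z : List α) (i : Fin L) => z[(i : ℕ)]?) S := by
    intro y hy z hz he
    refine List.ext_getElem? fun i => ?_
    by_cases hi : i < L
    · exact congrFun he ⟨i, hi⟩
    · have h1 := h y hy
      have h2 := h z hz
      rw [List.getElem?_eq_none (by omega), List.getElem?_eq_none (by omega)]
  calc S.card = (S.image fun (z : List α) (i : Fin L) => z[(i : ℕ)]?).card :=
        (Finset.card_image_of_injOn hinj).symm
    _ ≤ Fintype.card (Fin L → Option α) := Finset.card_le_univ _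
    _ = _ := by simp

/-- A large tree takes a long time to build. -/
lemma mul_visits_root_le {𝒜 : Type*} [Fintype 𝒜] [DecidableEq 𝒜] (x : ℕ → 𝒜) (n L : ℕ) :
    L * visits x n [] ≤ n + L * (Fintype.card 𝒜 + 1) ^ L := by
  have h1 : visits x n [] ≤ (stateAt x n).tree.card := by
    rw [card_tree, phrase_eq]; omega
  have h2 := sum_length_tree x n
  have h3 := Finset.card_filter_add_card_filter_not (s := (stateAt x n).tree) (fun z => z.length < L)
  have h4 : ((stateAt x n).tree.filter fun z => z.length < L).card ≤ (Fintype.card 𝒜 + 1) ^ L :=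
    card_le_of_length_lt fun z hz => (Finset.mem_filter.1 hz).2
  have h5 : L * ((stateAt x n).tree.filter fun z => ¬ z.length < L).card ≤
      ∑ z ∈ (stateAt x n).tree, z.length := by
    rw [mul_comm, ← smul_eq_mul]
    refine (Finset.card_nsmul_le_sum _ _ L fun z hz => not_lt.1 (Finset.mem_filter.1 hz).2).trans ?_
    exact Finset.sum_le_sum_of_subset (Finset.filter_subset _ _)
  calc L * visits x n [] ≤ L * (stateAt x n).tree.card := by gcongr
    _ ≤ n + L * (Fintype.card 𝒜 + 1) ^ L := by
      rw [← h3, mul_add]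
      have := Nat.mul_le_mul_left L h4
      omega

/-- The number `R` of phrases satisfies `R log R = O(n)`. -/
lemma exists_phrase_rate (𝒜 : Type*) [Fintype 𝒜] [DecidableEq 𝒜] : ∃ c : ℝ, 0 < c ∧ ∃ j₀ : ℕ,
    ∀ (x : ℕ → 𝒜) (n j : ℕ), j₀ ≤ j → 2 ^ j < visits x n [] →
      c * (2 ^ (j + 1) * ((j : ℝ) + 2)) ≤ n := by
  set p := Fintype.card 𝒜 + 1
  have hp : p ≤ 2 ^ p := Nat.lt_two_pow_self.le
  have hp0 : 1 ≤ p := by omega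
  refine ⟨1 / (16 * p), by positivity, 2 * p + 4, fun x n j hj hR => ?_⟩
  -- This depth keeps `p ^ L` at most `2 ^ (j - 1)`, half of the number of phrases, so at least `2 ^
  -- (j - 1)` nodes have depth at least `L` and cost `L` steps each. The bound `j ≥ 2 * p + 4` makes
  -- `p * L` comparable to `j`.
  set L := (j - 1) / p
  have hL1 : p * L ≤ j - 1 := Nat.mul_div_le _ _
  have hL2 : j - 1 < p * L + p := by
    have := Nat.lt_mul_div_succ (j - 1) (show 0 < p by omega)
    rw [mul_add, mul_one] at this
    exact this
  have h1 := mul_visits_root_le x n L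
  have h2 : p ^ L ≤ 2 ^ (j - 1) := by
    calc p ^ L ≤ (2 ^ p) ^ L := Nat.pow_le_pow_left hp L
      _ = 2 ^ (p * L) := by rw [pow_mul]
      _ ≤ 2 ^ (j - 1) := Nat.pow_le_pow_right (by norm_num) hL1
  have h3 : (2 : ℕ) ^ j = 2 * 2 ^ (j - 1) := by
    rw [← pow_succ']; congr 1; omega
  have h4 : L * 2 ^ (j - 1) ≤ n := by
    have e1 : L * (2 * 2 ^ (j - 1)) ≤ L * visits x n [] := Nat.mul_le_mul_left L (h3 ▸ hR.le)
    have e2 : L * p ^ L ≤ L * 2 ^ (j - 1) := Nat.mul_le_mul_left L h2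
    have e3 : L * (2 * 2 ^ (j - 1)) = L * 2 ^ (j - 1) + L * 2 ^ (j - 1) := by ring
    change L * visits x n [] ≤ n + L * p ^ L at h1
    omega
  have h5 : j + 2 ≤ 4 * (p * L) := by omega
  have h6 : 2 ^ (j + 1) * (j + 2) ≤ 16 * p * n := by
    calc 2 ^ (j + 1) * (j + 2) ≤ 2 ^ (j + 1) * (4 * (p * L)) := Nat.mul_le_mul_left _ h5
      _ = 16 * p * (L * 2 ^ (j - 1)) := by rw [pow_succ, h3]; ring
      _ ≤ 16 * p * n := Nat.mul_le_mul_left _ h4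
  have h7 : (2 : ℝ) ^ (j + 1) * (j + 2) ≤ 16 * p * n := by exact_mod_cast h6
  rw [div_mul_eq_mul_div, one_mul, div_le_iff₀ (by positivity)]
  linarith

lemma tendsto_visits_root {𝒜 : Type*} [DecidableEq 𝒜] (x : ℕ → 𝒜) :
    Tendsto (fun n => visits x n []) atTop atTop := by
  refine tendsto_atTop_atTop_of_monotone (visits_mono x []) fun K => ?_
  obtain ⟨t, ht⟩ := exists_phrase_gt x K
  exact ⟨t + 1, ht.le⟩

/-- Dyadic averages of functions with bounded integrals grow slowly. -/
lemma ae_tendsto_dyadic_sum {Ω : Type*} [MeasurableSpace Ω] (P : Measure Ω) {Q : ℕ → Ω → ℝ≥0∞}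
    (hQ : ∀ m, Measurable (Q m)) {C : ℝ≥0∞} (hC : C ≠ ∞) (hQC : ∀ m, ∫⁻ ω, Q m ω ∂P ≤ C) :
    ∀ᵐ ω ∂P, Tendsto
      (fun j : ℕ => ENNReal.ofReal (1 / (2 ^ j * ((j : ℝ) + 1) ^ 2)) *
        ∑ m ∈ Finset.range (2 ^ j), Q m ω) atTop (𝓝 0) := by
  have hm : ∀ j : ℕ, Measurable fun ω => ENNReal.ofReal (1 / (2 ^ j * ((j : ℝ) + 1) ^ 2)) *
        ∑ m ∈ Finset.range (2 ^ j), Q m ω := fun j =>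
    (Finset.measurable_sum _ fun m _ => hQ m).const_mul _
  have hsum : Summable fun j : ℕ => 1 / ((j : ℝ) + 1) ^ 2 := by
    have := (summable_nat_add_iff 1).2 (Real.summable_one_div_nat_pow.2 (one_lt_two))
    simpa using this
  -- The `j`-th term has mean at most `C / (j + 1) ^ 2`. The series thus has finite mean, and its
  -- terms tend to zero almost surely, without any independence.
  have hint : ∫⁻ ω, ∑' j : ℕ, ENNReal.ofReal (1 / (2 ^ j * ((j : ℝ) + 1) ^ 2)) *
        ∑ m ∈ Finset.range (2 ^ j), Q m ω ∂P ≠ ∞ := by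
    rw [lintegral_tsum fun j => (hm j).aemeasurable]
    have hle : ∀ j : ℕ, ∫⁻ ω, ENNReal.ofReal (1 / (2 ^ j * ((j : ℝ) + 1) ^ 2)) *
        ∑ m ∈ Finset.range (2 ^ j), Q m ω ∂P ≤ ENNReal.ofReal (1 / ((j : ℝ) + 1) ^ 2) * C := by
      intro j
      rw [lintegral_const_mul _ (Finset.measurable_sum _ fun m _ => hQ m),
        lintegral_finsetSum _ fun m _ => hQ m]
      calc _ ≤ ENNReal.ofReal (1 / (2 ^ j * ((j : ℝ) + 1) ^ 2)) *
            ∑ m ∈ Finset.range (2 ^ j), C := by gcongr with m _; exact hQC m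
        _ = ENNReal.ofReal (1 / (2 ^ j * ((j : ℝ) + 1) ^ 2)) * ENNReal.ofReal (2 ^ j) * C := by
            rw [Finset.sum_const, Finset.card_range, nsmul_eq_mul, mul_assoc]
            congr 2
            rw [ENNReal.ofReal_pow (by norm_num)]
            simp
        _ = _ := by
            rw [← ENNReal.ofReal_mul (by positivity)]
            congr 2
            field_simp
    refine ne_top_of_le_ne_top ?_ (ENNReal.tsum_le_tsum hle)
    rw [ENNReal.tsum_mul_right]
    refine ENNReal.mul_ne_top ?_ hC
    rw [← ENNReal.ofReal_tsum_of_nonneg (fun _ => by positivity) hsum]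
    exact ENNReal.ofReal_ne_top
  filter_upwards [ae_lt_top (Measurable.tsum hm) hint] with ω hω
  exact ENNReal.tendsto_atTop_zero_of_tsum_ne_top hω.ne

/-! ### Deviations at a fixed visit number -/

section Model

variable {𝒜 M : Type*} [DecidableEq 𝒜]

/-- For the parameters of the first `v` nodes that are visited for the `m`-th time, the sum of `f`
is exceptionally large. -/
def deviates (F : M → unitInterval → 𝒜) (f : M → ℝ) (ε : ℝ) (m v : ℕ) : Set (Sample 𝒜 M) :=
  {ω | ENNReal.ofReal (Real.exp (ε ^ 2 * v)) ≤
    walk F (fun x => ENNReal.ofReal (Real.exp (ε * f x))) m v ω +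
    walk F (fun x => ENNReal.ofReal (Real.exp (-ε * f x))) m v ω}

lemma exp_sum_le_walk (F : M → unitInterval → 𝒜) (f : M → ℝ) (l : ℝ) (m n : ℕ)
    (ω : Sample 𝒜 M) :
    ENNReal.ofReal (Real.exp (l * ∑ z ∈ frequent (symbols F ω) m n, f (ω.2 z))) ≤
      walk F (fun x => ENNReal.ofReal (Real.exp (l * f x))) m
        (frequent (symbols F ω) m n).card ω := by
  refine le_iSup_of_le n ?_
  rw [if_pos rfl, Finset.mul_sum, Real.exp_sum,
    ENNReal.ofReal_prod_of_nonneg fun _ _ => (Real.exp_pos _).le]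

/-- Each of the two exponentials stays below `exp (ε ^ 2 * v)`; taking logarithms and dividing by
`ε` bounds the sum on both sides. Here `v` is the random number of frequent nodes at time `n`. -/
lemma abs_sum_le_of_notMem_deviates {F : M → unitInterval → 𝒜} {f : M → ℝ} {ε : ℝ} (hε : 0 < ε)
    {m n : ℕ} {ω : Sample 𝒜 M}
    (h : ω ∉ deviates F f ε m (frequent (symbols F ω) m n).card) :
    |∑ z ∈ frequent (symbols F ω) m n, f (ω.2 z)| ≤ ε * (frequent (symbols F ω) m n).card := by
  have key : ∀ l : ℝ, ENNReal.ofReal (Real.exp (l * ∑ z ∈ frequent (symbols F ω) m n, f (ω.2 z))) <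
      ENNReal.ofReal (Real.exp (ε ^ 2 * (frequent (symbols F ω) m n).card)) →
      l * ∑ z ∈ frequent (symbols F ω) m n, f (ω.2 z) ≤
        ε * (ε * (frequent (symbols F ω) m n).card) := by
    intro l hl
    rw [ENNReal.ofReal_lt_ofReal_iff (Real.exp_pos _), Real.exp_lt_exp] at hl
    linarith [show ε ^ 2 * ((frequent (symbols F ω) m n).card : ℝ) =
      ε * (ε * (frequent (symbols F ω) m n).card) by ring]
  have hlt := h
  rw [deviates, Set.notMem_ofPred_iff, not_le] at hlt
  have h1 := key ε (((exp_sum_le_walk F f ε m n ω).trans le_self_add).trans_lt hlt)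
  have h2 := key (-ε) (((exp_sum_le_walk F f (-ε) m n ω).trans le_add_self).trans_lt hlt)
  rw [abs_le]
  constructor
  · have : ε * -(∑ z ∈ frequent (symbols F ω) m n, f (ω.2 z)) ≤
        ε * (ε * (frequent (symbols F ω) m n).card) := by linarith
    linarith [le_of_mul_le_mul_left this hε]
  · exact le_of_mul_le_mul_left h1 hε

variable [MeasurableSpace M]

/-- Hoeffding's lemma: on an interval of length `2` the variance proxy is `1`. -/
lemma lintegral_exp_le (μ : Measure M) [IsProbabilityMeasure μ] {f : M → ℝ} (hf : Measurable f)
    (hb : ∀ x, |f x| ≤ 1) (h0 : ∫ x, f x ∂μ = 0) (l : ℝ) :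
    ∫⁻ x, ENNReal.ofReal (Real.exp (l * f x)) ∂μ ≤ ENNReal.ofReal (Real.exp (l ^ 2 / 2)) := by
  have hs := hasSubgaussianMGF_of_mem_Icc_of_integral_eq_zero (μ := μ) (X := f) (a := -1) (b := 1)
    hf.aemeasurable (ae_of_all _ fun x => abs_le.1 (hb x)) h0
  rw [← ofReal_integral_eq_lintegral_ofReal (hs.integrable_exp_mul l)
    (ae_of_all _ fun _ => (Real.exp_pos _).le)]
  refine ENNReal.ofReal_le_ofReal ((hs.mgf_le l).trans_eq ?_)
  congr 1
  norm_num

variable [Countable 𝒜] [Nonempty 𝒜] [MeasurableSpace 𝒜] [MeasurableSingletonClass 𝒜]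

lemma measurableSet_deviates {F : M → unitInterval → 𝒜} (hF : Measurable (Function.uncurry F))
    {f : M → ℝ} (hf : Measurable f) (ε : ℝ) (m v : ℕ) : MeasurableSet (deviates F f ε m v) := by
  refine measurableSet_le measurable_const ((measurable_walk hF ?_ m v).add
    (measurable_walk hF ?_ m v)) <;> fun_prop

/-- Markov's inequality: each sign has mean at most `exp (ε ^ 2 * v / 2)`, against the threshold
`exp (ε ^ 2 * v)`. -/
lemma measure_deviates_le {F : M → unitInterval → 𝒜} (hF : Measurable (Function.uncurry F))
    (μ : Measure M) [IsProbabilityMeasure μ] {f : M → ℝ} (hf : Measurable f)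
    (hb : ∀ x, |f x| ≤ 1) (h0 : ∫ x, f x ∂μ = 0) (ε : ℝ) (m v : ℕ) :
    sampleLaw 𝒜 μ (deviates F f ε m v) ≤ ENNReal.ofReal (2 * Real.exp (-(ε ^ 2 / 2)) ^ v) := by
  have hg : ∀ l : ℝ, Measurable fun x => ENNReal.ofReal (Real.exp (l * f x)) := by
    intro l; fun_prop
  have hw : ∀ l : ℝ, ∫⁻ ω, walk F (fun x => ENNReal.ofReal (Real.exp (l * f x))) m v ω
      ∂sampleLaw 𝒜 μ ≤ ENNReal.ofReal (Real.exp (l ^ 2 / 2) ^ v) := by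
    intro l
    refine (lintegral_walk_le hF (hg l) μ m v).trans ?_
    rw [ENNReal.ofReal_pow (Real.exp_pos _).le]
    gcongr
    exact lintegral_exp_le μ hf hb h0 l
  refine (meas_ge_le_lintegral_div ((measurable_walk hF (hg ε) m v).add
    (measurable_walk hF (hg (-ε)) m v)).aemeasurable (by simp [Real.exp_pos])
    ENNReal.ofReal_ne_top).trans ?_
  refine ENNReal.div_le_of_le_mul ?_
  simp only [Pi.add_apply]
  rw [lintegral_add_left (measurable_walk hF (hg ε) m v),
    ← ENNReal.ofReal_mul (by positivity)]
  refine (add_le_add (hw ε) (hw (-ε))).trans ?_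
  rw [← ENNReal.ofReal_add (by positivity) (by positivity)]
  refine ENNReal.ofReal_le_ofReal (le_of_eq ?_)
  rw [neg_sq, ← two_mul, mul_assoc, ← Real.exp_nat_mul, ← Real.exp_nat_mul, ← Real.exp_add]
  congr 2
  ring

/-- The total of `v²` over all exceptional `v`. -/
noncomputable def excess (F : M → unitInterval → 𝒜) (f : M → ℝ) (ε : ℝ) (m : ℕ)
    (ω : Sample 𝒜 M) : ℝ≥0∞ :=
  ∑' v : ℕ, (deviates F f ε m v).indicator (fun _ => ENNReal.ofReal ((v : ℝ) ^ 2)) ω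

lemma measurable_excess {F : M → unitInterval → 𝒜} (hF : Measurable (Function.uncurry F))
    {f : M → ℝ} (hf : Measurable f) (ε : ℝ) (m : ℕ) : Measurable (excess F f ε m) :=
  Measurable.tsum fun v => measurable_const.indicator (measurableSet_deviates hF hf ε m v)

/-- The deviation probabilities decay geometrically in `v`, at a rate free of `m`, and so absorb the
weight `v ^ 2`. The square is what Cauchy–Schwarz over `m` will need. -/
lemma lintegral_excess_le {F : M → unitInterval → 𝒜} (hF : Measurable (Function.uncurry F))
    (μ : Measure M) [IsProbabilityMeasure μ] {f : M → ℝ} (hf : Measurable f)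
    (hb : ∀ x, |f x| ≤ 1) (h0 : ∫ x, f x ∂μ = 0) {ε : ℝ} (hε : 0 < ε) :
    ∃ C : ℝ≥0∞, C ≠ ∞ ∧ ∀ m, ∫⁻ ω, excess F f ε m ω ∂sampleLaw 𝒜 μ ≤ C := by
  have hr : Summable fun v : ℕ => (v : ℝ) ^ 2 * (2 * Real.exp (-(ε ^ 2 / 2)) ^ v) := by
    have h1 : Real.exp (-(ε ^ 2 / 2)) < 1 := by
      rw [Real.exp_lt_one_iff]
      have : 0 < ε ^ 2 := by positivity
      linarith
    have h2 := (summable_pow_mul_geometric_of_norm_lt_one 2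
      (r := Real.exp (-(ε ^ 2 / 2))) (by rwa [Real.norm_of_nonneg (Real.exp_pos _).le])).mul_left 2
    refine h2.congr fun v => ?_
    ring
  refine ⟨ENNReal.ofReal (∑' v : ℕ, (v : ℝ) ^ 2 * (2 * Real.exp (-(ε ^ 2 / 2)) ^ v)),
    ENNReal.ofReal_ne_top, fun m => ?_⟩
  unfold excess
  rw [lintegral_tsum fun v => (measurable_const.indicator
    (measurableSet_deviates hF hf ε m v)).aemeasurable,
    ENNReal.ofReal_tsum_of_nonneg (fun _ => by positivity) hr]
  refine ENNReal.tsum_le_tsum fun v => ?_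
  rw [lintegral_indicator_const (measurableSet_deviates hF hf ε m v),
    ENNReal.ofReal_mul (by positivity)]
  gcongr
  exact measure_deviates_le hF μ hf hb h0 ε m v

end Model

/-! ### Law of large numbers in the sampled process -/

section Average

variable {𝒜 M : Type*} [DecidableEq 𝒜]

/-- The sum of `f` along the run is small up to the exceptional visit numbers. -/
lemma abs_sum_node_le {F : M → unitInterval → 𝒜} {f : M → ℝ} (hb : ∀ x, |f x| ≤ 1) {ε : ℝ}
    (hε : 0 < ε) (ω : Sample 𝒜 M) (n : ℕ) :
    ∃ d : ℕ → ℝ, (∀ m, ENNReal.ofReal (d m ^ 2) ≤ excess F f ε m ω) ∧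
      |∑ t ∈ Finset.range n, f (ω.2 (node (symbols F ω) t))| ≤
        ε * n + ∑ m ∈ Finset.range (visits (symbols F ω) n []), d m := by
  classical
  set x := symbols F ω
  have hx : Follows (table F ω) x := follows_symbols F ω
  -- At an exceptional visit number the trivial bound by the number of nodes is used; its square is
  -- a single term of `excess`.
  refine ⟨fun m => if ω ∈ deviates F f ε m (frequent x m n).card then (frequent x m n).card else 0,
    fun m => ?_, ?_⟩
  · simp only
    split_ifs with h
    · refine le_trans ?_ (ENNReal.le_tsum (frequent x m n).card)
      rw [Set.indicator_of_mem h]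
    · simp
  · rw [hx.sum_node_eq (fun z => f (ω.2 z)) n le_rfl]
    -- Grouping the constant `1` shows that the errors `ε * card` of the unexceptional visit numbers
    -- add up to at most `ε * n`.
    have hn : (n : ℝ) = ∑ m ∈ Finset.range (visits x n []), ((frequent x m n).card : ℝ) := by
      have := hx.sum_node_eq (fun _ => (1 : ℝ)) n le_rfl
      simpa using this
    rw [hn, Finset.mul_sum, ← Finset.sum_add_distrib]
    refine (Finset.abs_sum_le_sum_abs _ _).trans (Finset.sum_le_sum fun m _ => ?_)
    split_ifs with h
    · have h1 : |∑ z ∈ frequent x m n, f (ω.2 z)| ≤ (frequent x m n).card := by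
        refine (Finset.abs_sum_le_sum_abs _ _).trans ?_
        refine (Finset.sum_le_card_nsmul _ _ 1 fun z _ => hb _).trans (by simp)
      have h2 : 0 ≤ ε * ((frequent x m n).card : ℝ) := by positivity
      linarith
    · rw [add_zero]
      exact abs_sum_le_of_notMem_deviates hε h

variable [Fintype 𝒜]

lemma eventually_abs_sum_node_le {F : M → unitInterval → 𝒜} {f : M → ℝ} (hb : ∀ x, |f x| ≤ 1)
    {ε : ℝ} (hε : 0 < ε) (ω : Sample 𝒜 M)
    (h : Tendsto (fun j : ℕ => ENNReal.ofReal (1 / (2 ^ j * ((j : ℝ) + 1) ^ 2)) *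
        ∑ m ∈ Finset.range (2 ^ j), excess F f ε m ω) atTop (𝓝 0)) :
    ∀ᶠ n : ℕ in atTop,
      |∑ t ∈ Finset.range n, f (ω.2 (node (symbols F ω) t))| ≤ 2 * ε * n := by
  obtain ⟨c, hc, j₀, hrate⟩ := exists_phrase_rate 𝒜
  -- With this threshold, Cauchy–Schwarz yields `ε` times exactly the quantity that
  -- `exists_phrase_rate` bounds by `n`.
  have hδ : (0 : ℝ≥0∞) < ENNReal.ofReal ((ε * c) ^ 2) := by
    rw [ENNReal.ofReal_pos]; positivity
  obtain ⟨j₁, hj₁⟩ := eventually_atTop.1 (h.eventually (gt_mem_nhds hδ))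
  filter_upwards [(tendsto_visits_root (symbols F ω)).eventually_gt_atTop (2 ^ (max j₀ j₁))]
    with n hn
  set R := visits (symbols F ω) n []
  obtain ⟨d, hd, hsum⟩ := abs_sum_node_le (F := F) hb hε ω n
  refine hsum.trans ?_
  obtain ⟨j, hj, hj1, hj2⟩ : ∃ j, max j₀ j₁ ≤ j ∧ 2 ^ j < R ∧ R ≤ 2 ^ (j + 1) := by
    have hR : 1 < R := lt_of_le_of_lt Nat.one_le_two_pow hn
    have h1 : max j₀ j₁ < Nat.clog 2 R := (Nat.lt_clog_iff_pow_lt (by norm_num)).2 hn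
    refine ⟨Nat.clog 2 R - 1, by omega, ?_, ?_⟩
    · exact Nat.pow_pred_clog_lt_self (by norm_num) hR
    · rw [Nat.sub_add_cancel (by omega)]
      exact Nat.le_pow_clog (by norm_num) R
  have hrate' := hrate (symbols F ω) n j ((le_max_left _ _).trans hj) hj1
  -- The block of length `2 ^ (j + 1)` covers all visit numbers below `R`; its weight `(j + 2) ^ 2`
  -- matches the factor `j + 2` in the rate.
  have hw := (hj₁ (j + 1) (((le_max_right _ _).trans hj).trans (Nat.le_succ j))).le
  have hsq : ∑ m ∈ Finset.range R, d m ^ 2 ≤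
      (ε * c) ^ 2 * (2 ^ (j + 1) * ((j : ℝ) + 2) ^ 2) := by
    have e1 : ENNReal.ofReal (∑ m ∈ Finset.range R, d m ^ 2) ≤
        ∑ m ∈ Finset.range (2 ^ (j + 1)), excess F f ε m ω := by
      rw [ENNReal.ofReal_sum_of_nonneg fun _ _ => sq_nonneg _]
      refine (Finset.sum_le_sum fun m _ => hd m).trans ?_
      exact Finset.sum_le_sum_of_subset (Finset.range_subset_range.2 hj2)
    have e2 := (mul_le_mul_right e1
      (ENNReal.ofReal (1 / (2 ^ (j + 1) * (((j + 1 : ℕ) : ℝ) + 1) ^ 2)))).trans hw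
    rw [← ENNReal.ofReal_mul (by positivity), ENNReal.ofReal_le_ofReal_iff (by positivity),
      div_mul_eq_mul_div, one_mul, div_le_iff₀ (by positivity)] at e2
    push_cast at e2
    rwa [add_assoc, one_add_one_eq_two] at e2
  have hS : (∑ m ∈ Finset.range R, d m) ^ 2 ≤ (ε * n) ^ 2 := by
    have hR : (R : ℝ) ≤ 2 ^ (j + 1) := by exact_mod_cast hj2
    calc (∑ m ∈ Finset.range R, d m) ^ 2 ≤ R * ∑ m ∈ Finset.range R, d m ^ 2 := by
          simpa using sq_sum_le_card_mul_sum_sq (s := Finset.range R) (f := d)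
      _ ≤ 2 ^ (j + 1) * ((ε * c) ^ 2 * (2 ^ (j + 1) * ((j : ℝ) + 2) ^ 2)) := by
          have : 0 ≤ ∑ m ∈ Finset.range R, d m ^ 2 := Finset.sum_nonneg fun _ _ => sq_nonneg _
          gcongr
      _ = (ε * (c * (2 ^ (j + 1) * ((j : ℝ) + 2)))) ^ 2 := by ring
      _ ≤ (ε * n) ^ 2 := by gcongr
  have := abs_le_of_sq_le_sq' hS (by positivity)
  linarith [this.2]

variable [Nonempty 𝒜] [MeasurableSpace 𝒜] [MeasurableSingletonClass 𝒜] [MeasurableSpace M]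

/-- In the sampled process, averages of centred bounded functions of the parameters vanish. -/
lemma ae_tendsto_average_node {F : M → unitInterval → 𝒜} (hF : Measurable (Function.uncurry F))
    (μ : Measure M) [IsProbabilityMeasure μ] {f : M → ℝ} (hf : Measurable f)
    (hb : ∀ x, |f x| ≤ 1) (h0 : ∫ x, f x ∂μ = 0) :
    ∀ᵐ ω ∂sampleLaw 𝒜 μ, Tendsto
      (fun n : ℕ => (n : ℝ)⁻¹ * ∑ t ∈ Finset.range n, f (ω.2 (node (symbols F ω) t)))
      atTop (𝓝 0) := by
  have hall : ∀ k : ℕ, ∀ᵐ ω ∂sampleLaw 𝒜 μ, ∀ᶠ n : ℕ in atTop,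
      |∑ t ∈ Finset.range n, f (ω.2 (node (symbols F ω) t))| ≤ 2 * (1 / ((k : ℝ) + 1)) * n := by
    intro k
    have hk : (0 : ℝ) < 1 / ((k : ℝ) + 1) := by positivity
    obtain ⟨C, hC, hle⟩ := lintegral_excess_le hF μ hf hb h0 hk
    filter_upwards [ae_tendsto_dyadic_sum _ (fun m => measurable_excess hF hf _ m) hC hle] with ω hω
    exact eventually_abs_sum_node_le hb hk ω hω
  filter_upwards [ae_all_iff.2 hall] with ω hω
  rw [Metric.tendsto_atTop']
  intro ε hε
  obtain ⟨k, hk⟩ := exists_nat_one_div_lt (half_pos hε)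
  obtain ⟨N, hN⟩ := eventually_atTop.1 (hω k)
  refine ⟨N, fun n hn => ?_⟩
  have hn0 : (0 : ℝ) < n := by exact_mod_cast (Nat.zero_le N).trans_lt hn
  rw [dist_zero_right, Real.norm_eq_abs, abs_mul, abs_of_pos (inv_pos.2 hn0), inv_mul_lt_iff₀ hn0]
  refine (hN n hn.le).trans_lt ?_
  rw [mul_comm]
  gcongr
  linarith

end Average

/-! ### The law of the parameters along the process -/

/-- Integration over an event of known conditional probability. -/
lemma setLIntegral_inter_of_condExp {Ω : Type*} {m m0 : MeasurableSpace Ω} {P : Measure Ω}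
    [IsFiniteMeasure P] (hm : m ≤ m0) {S : Set Ω} (hS : MeasurableSet S) {q : Ω → ℝ}
    (hq : P⟦S | m⟧ =ᵐ[P] q) (hq0 : ∀ ω, 0 ≤ q ω) (hqm : Measurable q) {φ : Ω → ℝ≥0∞}
    (hφ : Measurable[m] φ) {G : Set Ω} (hG : MeasurableSet[m] G) :
    ∫⁻ ω in G ∩ S, φ ω ∂P = ∫⁻ ω in G, φ ω * ENNReal.ofReal (q ω) ∂P := by
  have hqi : Integrable q P := integrable_condExp.congr hq
  -- On the sub-σ-algebra, restricting to `S` and weighting by `q` give the same measure; this is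
  -- the definition of the conditional probability.
  have hmeas : (P.restrict S).trim hm =
      (P.withDensity fun ω => ENNReal.ofReal (q ω)).trim hm := by
    refine @Measure.ext _ m _ _ fun A hA => ?_
    rw [trim_measurableSet_eq hm hA, trim_measurableSet_eq hm hA, withDensity_apply _ (hm A hA),
      Measure.restrict_apply (hm A hA),
      ← ofReal_integral_eq_lintegral_ofReal hqi.integrableOn (ae_of_all _ hq0),
      ← setIntegral_congr_ae (hm A hA) (hq.mono fun ω h _ => h),
      setIntegral_condExp hm ((integrable_const 1).indicator hS) hA, integral_indicator_const _ hS,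
      smul_eq_mul, mul_one, measureReal_restrict_apply hS, Set.inter_comm,
      ofReal_measureReal]
  have hφG : Measurable[m] (G.indicator φ) := hφ.indicator hG
  have h1 : ∫⁻ ω, G.indicator φ ω ∂P.restrict S =
      ∫⁻ ω, G.indicator φ ω ∂P.withDensity fun ω => ENNReal.ofReal (q ω) := by
    rw [← lintegral_trim hm hφG, hmeas, lintegral_trim hm hφG]
  rw [lintegral_indicator (hm G hG), Measure.restrict_restrict (hm G hG)] at h1
  rw [h1, lintegral_withDensity_eq_lintegral_mul _ hqm.ennreal_ofReal (hφG.mono hm le_rfl),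
    ← lintegral_indicator (hm G hG)]
  refine lintegral_congr fun ω => ?_
  by_cases hω : ω ∈ G
  · simp [hω, mul_comm]
  · simp [hω]

lemma lintegral_eq_tsum_history {α Ω : Type*} [Countable α] [Nonempty α] [MeasurableSpace α]
    [MeasurableSingletonClass α] [MeasurableSpace Ω] (P : Measure Ω) {X : ℕ → Ω → α}
    (hX : ∀ t, Measurable (X t)) (n : ℕ) (φ : Ω → ℝ≥0∞) :
    ∫⁻ ω, φ ω ∂P =
      ∑' w : Fin n → α, ∫⁻ ω in {ω | ∀ s < n, X s ω = extendSeq w s}, φ ω ∂P := by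
  have hw : ∀ (w : Fin n → α) ω, (∀ s < n, X s ω = extendSeq w s) ↔ (fun s : Fin n => X s ω) = w := by
    intro w ω
    rw [funext_iff]
    constructor
    · intro h s
      rw [h s s.2, extendSeq, dif_pos s.2]
    · intro h s hs
      rw [extendSeq, dif_pos hs, ← h ⟨s, hs⟩]
  rw [← lintegral_iUnion, ← setLIntegral_univ]
  · congr 2
    ext ω
    simp only [Set.mem_univ, Set.mem_iUnion, Set.mem_ofPred_eq, hw, true_iff]
    exact ⟨_, rfl⟩
  · intro w
    simp only [hw]
    exact (measurable_pi_lambda (fun ω (s : Fin n) => X s ω) fun s => hX s)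
      (measurableSet_singleton w)
  · intro w w' hne
    refine Set.disjoint_left.2 fun ω h1 h2 => hne ?_
    rw [Set.mem_ofPred_eq, hw] at h1 h2
    exact h1.symm.trans h2

/-- The parameters of the current nodes have the same law, whether they are chosen by node or in
the order of first visits. -/
lemma lintegral_params_eq {𝒜 M : Type*} [DecidableEq 𝒜] [MeasurableSpace M] (μ : Measure M)
    [IsProbabilityMeasure μ] (w : ℕ → 𝒜) (n : ℕ) {G : (Fin n → M) → ℝ≥0∞} (hG : Measurable G) :
    ∫⁻ θ, G (fun t => θ (paramIndex (List.ofFn fun i : Fin (t : ℕ) => w i)))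
        ∂Measure.infinitePi (fun _ : ℕ => μ) =
      ∫⁻ θ, G (fun t => θ (node w t)) ∂Measure.infinitePi (fun _ : List 𝒜 => μ) := by
  -- Once the word is fixed, both sides read an i.i.d. family along an injective list of `l.length`
  -- coordinates: the numbers `0, 1, …` on one side, the nodes of `l` on the other.
  set l := (stateAt w n).labelled
  have hmem : ∀ t : Fin n, node w t ∈ l := fun t => (paramIndex_eq_idxOf w t.2).1
  let idx : Fin n → Fin l.length := fun t => ⟨l.idxOf (node w t), List.idxOf_lt_length_of_mem (hmem t)⟩
  have hget : ∀ t, l.get (idx t) = node w t := fun t => List.getElem_idxOf _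
  have hidx : ∀ t : Fin n, paramIndex (List.ofFn fun i : Fin (t : ℕ) => w i) = (idx t : ℕ) :=
    fun t => (paramIndex_eq_idxOf w t.2).2
  have hinj : Function.Injective l.get := List.nodup_iff_injective_get.1 (labelled_nodup w n)
  have hG' : Measurable fun φ : Fin l.length → M => G fun t => φ (idx t) :=
    hG.comp (measurable_pi_lambda _ fun t => measurable_pi_apply _)
  have h1 := lintegral_map (μ := Measure.infinitePi fun _ : ℕ => μ) hG'
    (measurable_pi_lambda (fun (θ : ℕ → M) (i : Fin l.length) => θ i) fun i => measurable_pi_apply _)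
  have h2 := lintegral_map (μ := Measure.infinitePi fun _ : List 𝒜 => μ) hG'
    (measurable_pi_lambda (fun (θ : List 𝒜 → M) (i : Fin l.length) => θ (l.get i))
      fun i => measurable_pi_apply _)
  rw [Measure.map_infinitePi_infinitePi_of_inj Fin.val_injective] at h1
  rw [Measure.map_infinitePi_infinitePi_of_inj hinj] at h2
  simp only [hget] at h2
  simp only [hidx]
  exact h1.symm.trans h2

lemma measurable_coord {𝒜 : Type*} [Fintype 𝒜] (a : 𝒜) :
    Measurable fun x : stdSimplex ℝ 𝒜 => ENNReal.ofReal (x a) :=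
  ENNReal.measurable_ofReal.comp ((measurable_pi_apply a).comp measurable_subtype_coe)

section Simplex

variable {𝒜 : Type*} [Fintype 𝒜] [DecidableEq 𝒜]

variable [MeasurableSpace 𝒜]

lemma IsSource.map_param {μ : ProbabilityMeasure (stdSimplex ℝ 𝒜)} {Ω : Type*}
    [MeasurableSpace Ω] {P : Measure Ω} {Θ : ℕ → Ω → stdSimplex ℝ 𝒜}
    {X : ℕ → Ω → 𝒜} (hX : IsSource μ P Θ X) :
    P.map (fun ω j => Θ j ω) = Measure.infinitePi fun _ => (μ : Measure (stdSimplex ℝ 𝒜)) := by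
  rw [hX.indep_param.map_fun_eq_infinitePi_map hX.measurable_param]
  simp only [hX.law_param]

variable [MeasurableSingletonClass 𝒜]

/-- The joint law of the parameters and the first symbols of a source. -/
lemma IsSource.setLIntegral_eq {μ : ProbabilityMeasure (stdSimplex ℝ 𝒜)} {Ω : Type*}
    [MeasurableSpace Ω] {P : Measure Ω} [IsProbabilityMeasure P] {Θ : ℕ → Ω → stdSimplex ℝ 𝒜}
    {X : ℕ → Ω → 𝒜} (hX : IsSource μ P Θ X) (w : ℕ → 𝒜) (n : ℕ)
    {g : (ℕ → stdSimplex ℝ 𝒜) → ℝ≥0∞} (hg : Measurable g) :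
    ∫⁻ ω in {ω | ∀ s < n, X s ω = w s}, g (fun j => Θ j ω) ∂P =
      ∫⁻ ω, g (fun j => Θ j ω) * ∏ s ∈ Finset.range n,
        ENNReal.ofReal (Θ (paramIndex (List.ofFn fun i : Fin s => w i)) ω (w s)) ∂P := by
  induction n generalizing g with
  | zero => simp
  | succ n ih =>
    set ι := paramIndex (List.ofFn fun i : Fin n => w i)
    have hpm : Measurable fun ω => ((fun j => Θ j ω), (fun s : Fin n => X s ω)) :=
      (measurable_pi_lambda _ hX.measurable_param).prodMk
        (measurable_pi_lambda _ fun s : Fin n => hX.measurable_symbol s)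
    have hset : {ω | ∀ s < n + 1, X s ω = w s} = {ω | ∀ s < n, X s ω = w s} ∩ X n ⁻¹' {w n} := by
      ext ω
      exact Nat.forall_lt_succ_right
    have hnode : ∀ ω, (∀ s < n, X s ω = w s) → nodeParam Θ X n ω = Θ ι ω := by
      intro ω hω
      have : (fun s : Fin n => X s ω) = fun s : Fin n => w s := funext fun s => hω s s.2
      rw [nodeParam, this]
    have hqm : Measurable fun ω => nodeParam Θ X n ω (w n) := by
      have h1 : Measurable fun p : (Fin n → 𝒜) × (ℕ → stdSimplex ℝ 𝒜) =>
          p.2 (paramIndex (List.ofFn p.1)) (w n) :=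
        measurable_from_prod_countable_right fun x => (measurable_pi_apply (w n)).comp
          (measurable_subtype_coe.comp (measurable_pi_apply (paramIndex (List.ofFn x))))
      exact h1.comp (measurable_swap.comp hpm)
    have hEm : MeasurableSet {ω | ∀ s < n, X s ω = w s} := by
      simp only [Set.ofPred_forall]
      exact MeasurableSet.iInter fun s => MeasurableSet.iInter fun _ =>
        hX.measurable_symbol s (measurableSet_singleton _)
    rw [hset, setLIntegral_inter_of_condExp hpm.comap_le
      (hX.measurable_symbol n (measurableSet_singleton _)) (hX.cond_symbol n (w n))
      (fun ω => (nodeParam Θ X n ω).2.1 (w n)) hqm]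
    · rw [setLIntegral_congr_fun (g := fun ω => g (fun j => Θ j ω) * ENNReal.ofReal (Θ ι ω (w n)))
        hEm fun ω hω => by simp only [hnode ω hω]]
      -- The conditional probability of the last symbol is a function of the parameters, so it is
      -- absorbed into `g`; hence the induction over all `g`.
      rw [ih (g := fun θ => g θ * ENNReal.ofReal (θ ι (w n)))
        (hg.mul ((measurable_coord (w n)).comp (measurable_pi_apply ι)))]
      refine lintegral_congr fun ω => ?_
      rw [Finset.prod_range_succ, mul_assoc, mul_comm (ENNReal.ofReal _)]
    · exact (hg.comp measurable_fst).comp (comap_measurable _)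
    · refine ⟨{p | ∀ s : Fin n, p.2 s = w s}, ?_, ?_⟩
      · simp only [Set.ofPred_forall]
        exact MeasurableSet.iInter fun s =>
          ((measurable_pi_apply s).comp measurable_snd) (measurableSet_singleton _)
      · ext ω
        exact ⟨fun h s hs => h ⟨s, hs⟩, fun h s => h s s.2⟩

/-- The joint law of the parameters and the first symbols of the sampled process. -/
lemma setLIntegral_sampleLaw_eq [Nonempty 𝒜] {F : stdSimplex ℝ 𝒜 → unitInterval → 𝒜}
    (hF : Measurable (Function.uncurry F))
    (hFk : ∀ x, Measure.map (F x) volume = symbolKernel x) (μ : Measure (stdSimplex ℝ 𝒜))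
    [IsProbabilityMeasure μ] (w : ℕ → 𝒜) (n : ℕ) {g : (List 𝒜 → stdSimplex ℝ 𝒜) → ℝ≥0∞}
    (hg : Measurable g) :
    ∫⁻ ω in {ω | ∀ s < n, symbols F ω s = w s}, g ω.2 ∂sampleLaw 𝒜 μ =
      ∫⁻ θ, g θ * ∏ s ∈ Finset.range n, ENNReal.ofReal (θ (node w s) (w s))
        ∂Measure.infinitePi (fun _ => μ) := by
  have hEm : MeasurableSet {ω : Sample 𝒜 (stdSimplex ℝ 𝒜) | ∀ s < n, symbols F ω s = w s} := by
    simp only [Set.ofPred_forall]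
    exact MeasurableSet.iInter fun s => MeasurableSet.iInter fun _ =>
      measurable_symbols hF s (measurableSet_singleton _)
  have hgm : Measurable ({ω : Sample 𝒜 (stdSimplex ℝ 𝒜) | ∀ s < n, symbols F ω s = w s}.indicator
      fun ω => g ω.2) := (hg.comp measurable_snd).indicator hEm
  rw [← lintegral_indicator hEm, sampleLaw, lintegral_prod_symm' _ hgm]
  refine lintegral_congr fun θ => ?_
  set key : ℕ → List 𝒜 × ℕ := fun s => (node w s, visits w s (node w s))
  have hkey : Function.Injective key := node_visits_injective w
  -- For fixed parameters, producing the word is a box condition on distinct uniform variables, so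
  -- its probability is a product.
  set box : List 𝒜 × ℕ → Set unitInterval := fun p =>
    {u | ∀ s < n, key s = p → F (θ p.1) u = w s}
  have hFm : ∀ x, Measurable (F x) := fun x => hF.of_uncurry_left
  have hbox : ∀ p, MeasurableSet (box p) := by
    intro p
    simp only [box, Set.ofPred_forall]
    exact MeasurableSet.iInter fun s => MeasurableSet.iInter fun _ => MeasurableSet.iInter fun _ =>
      hFm _ (measurableSet_singleton _)
  have hset : (fun U => (U, θ)) ⁻¹' {ω : Sample 𝒜 (stdSimplex ℝ 𝒜) | ∀ s < n, symbols F ω s = w s} =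
      Set.pi ((Finset.range n).image key) box := by
    ext U
    simp only [Set.mem_preimage, Set.mem_ofPred_eq, symbols, run_eq_iff, Set.mem_pi, Finset.coe_image,
      Finset.coe_range, Set.mem_image, Set.mem_Iio, box, table]
    constructor
    · rintro h p - s hs rfl
      exact h s hs
    · intro h s hs
      exact h (key s) ⟨s, hs, rfl⟩ s hs rfl
  have hind : ∀ U, {ω : Sample 𝒜 (stdSimplex ℝ 𝒜) | ∀ s < n, symbols F ω s = w s}.indicator
      (fun ω => g ω.2) (U, θ) = (Set.pi ((Finset.range n).image key) box).indicator
        (fun _ => g θ) U := by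
    intro U
    rw [← hset]
    rfl
  simp only [hind]
  rw [lintegral_indicator_const (MeasurableSet.pi (Finset.countable_toSet _) fun p _ => hbox p),
    Measure.infinitePi_pi _ fun p _ => hbox p, Finset.prod_image fun _ _ _ _ h => hkey h]
  congr 1
  refine Finset.prod_congr rfl fun s hs => ?_
  have : box (key s) = F (θ (node w s)) ⁻¹' {w s} := by
    ext u
    simp only [box, Set.mem_ofPred_eq, Set.mem_preimage, Set.mem_singleton_iff]
    constructor
    · intro h
      exact h s (Finset.mem_range.1 hs) rfl
    · intro h s' _ he
      rw [hkey he]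
      exact h
  rw [this, ← Measure.map_apply (hFm _) (measurableSet_singleton _), hFk, ← symbolKernel_real,
    ofReal_measureReal]

/-- The first parameters have the same law in every source as in the sampled process. -/
lemma IsSource.lintegral_nodeParam_eq [Nonempty 𝒜] {μ : ProbabilityMeasure (stdSimplex ℝ 𝒜)}
    {Ω : Type*} [MeasurableSpace Ω] {P : Measure Ω} [IsProbabilityMeasure P]
    {Θ : ℕ → Ω → stdSimplex ℝ 𝒜} {X : ℕ → Ω → 𝒜} (hX : IsSource μ P Θ X)
    {F : stdSimplex ℝ 𝒜 → unitInterval → 𝒜} (hF : Measurable (Function.uncurry F))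
    (hFk : ∀ x, Measure.map (F x) volume = symbolKernel x) (n : ℕ)
    {G : (Fin n → stdSimplex ℝ 𝒜) → ℝ≥0∞} (hG : Measurable G) :
    ∫⁻ ω, G (fun t => nodeParam Θ X t ω) ∂P =
      ∫⁻ ω, G (fun t => ω.2 (node (symbols F ω) t)) ∂sampleLaw 𝒜 (μ : Measure (stdSimplex ℝ 𝒜)) := by
  rw [lintegral_eq_tsum_history P hX.measurable_symbol n,
    lintegral_eq_tsum_history _ (measurable_symbols hF) n]
  refine tsum_congr fun v => ?_
  set w := extendSeq v
  have h1 : ∫⁻ ω in {ω | ∀ s < n, X s ω = w s}, G (fun t => nodeParam Θ X t ω) ∂P =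
      ∫⁻ ω in {ω | ∀ s < n, X s ω = w s},
        G (fun t => Θ (paramIndex (List.ofFn fun i : Fin (t : ℕ) => w i)) ω) ∂P := by
    refine setLIntegral_congr_fun ?_ fun ω hω => ?_
    · simp only [Set.ofPred_forall]
      exact MeasurableSet.iInter fun s => MeasurableSet.iInter fun _ =>
        hX.measurable_symbol s (measurableSet_singleton _)
    · have : ∀ t : Fin n, (fun s : Fin (t : ℕ) => X s ω) = fun s : Fin (t : ℕ) => w s :=
        fun t => funext fun s => hω s (s.2.trans t.2)
      simp only [nodeParam, this]
  have h2 : ∫⁻ ω in {ω | ∀ s < n, symbols F ω s = w s}, G (fun t => ω.2 (node (symbols F ω) t))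
        ∂sampleLaw 𝒜 (μ : Measure (stdSimplex ℝ 𝒜)) =
      ∫⁻ ω in {ω | ∀ s < n, symbols F ω s = w s}, G (fun t => ω.2 (node w t))
        ∂sampleLaw 𝒜 (μ : Measure (stdSimplex ℝ 𝒜)) := by
    refine setLIntegral_congr_fun ?_ fun ω hω => ?_
    · simp only [Set.ofPred_forall]
      exact MeasurableSet.iInter fun s => MeasurableSet.iInter fun _ =>
        measurable_symbols hF s (measurableSet_singleton _)
    · have : ∀ t : Fin n, node (symbols F ω) t = node w t :=
        fun t => node_congr fun s hs => hω s (hs.trans t.2)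
      simp only [this]
  -- On both sides the word has the same likelihood as a function of the parameters met; only the
  -- indexing of the parameters differs.
  have hG1 : Measurable fun b : Fin n → stdSimplex ℝ 𝒜 =>
      G b * ∏ t : Fin n, ENNReal.ofReal (b t (w t)) :=
    hG.mul (Finset.measurable_prod _ fun t _ => (measurable_coord _).comp (measurable_pi_apply t))
  have hsel : Measurable fun (θ : ℕ → stdSimplex ℝ 𝒜) (t : Fin n) =>
      θ (paramIndex (List.ofFn fun i : Fin (t : ℕ) => w i)) :=
    measurable_pi_lambda _ fun t => measurable_pi_apply _
  rw [h1, h2, hX.setLIntegral_eq w n (g := fun θ =>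
      G (fun t => θ (paramIndex (List.ofFn fun i : Fin (t : ℕ) => w i)))) (hG.comp hsel),
    setLIntegral_sampleLaw_eq hF hFk _ w n (g := fun θ => G (fun t => θ (node w t)))
      (hG.comp (measurable_pi_lambda _ fun t => measurable_pi_apply _))]
  simp only [Finset.prod_range]
  rw [← lintegral_params_eq (μ : Measure (stdSimplex ℝ 𝒜)) w n hG1, ← hX.map_param]
  exact (lintegral_map (hG1.comp hsel) (measurable_pi_lambda _ hX.measurable_param)).symm

lemma measurable_nodeParam {Ω : Type*} [MeasurableSpace Ω] {Θ : ℕ → Ω → stdSimplex ℝ 𝒜}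
    {X : ℕ → Ω → 𝒜} (hΘ : ∀ j, Measurable (Θ j)) (hX : ∀ t, Measurable (X t)) (t : ℕ) :
    Measurable (nodeParam Θ X t) := by
  have h1 : Measurable fun p : (Fin t → 𝒜) × Ω => Θ (paramIndex (List.ofFn p.1)) p.2 :=
    measurable_from_prod_countable_right fun x => hΘ (paramIndex (List.ofFn x))
  exact h1.comp ((measurable_pi_lambda _ fun s : Fin t => hX s).prodMk measurable_id)

lemma measurable_param_node [Nonempty 𝒜] {F : stdSimplex ℝ 𝒜 → unitInterval → 𝒜}
    (hF : Measurable (Function.uncurry F)) (t : ℕ) :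
    Measurable fun ω : Sample 𝒜 (stdSimplex ℝ 𝒜) => ω.2 (node (symbols F ω) t) :=
  measurable_of_history (X := symbols F) (t := t) (Ψ := fun x ω => ω.2 (node x t))
    (fun x => (measurable_pi_apply (node x t)).comp measurable_snd)
    (fun x y hxy => by simp only [node_congr hxy]) fun s _ => measurable_symbols hF s

/-- The parameters have the same law in every source as in the sampled process. -/
lemma IsSource.map_nodeParam_eq [Nonempty 𝒜] {μ : ProbabilityMeasure (stdSimplex ℝ 𝒜)}
    {Ω : Type*} [MeasurableSpace Ω] {P : Measure Ω} [IsProbabilityMeasure P]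
    {Θ : ℕ → Ω → stdSimplex ℝ 𝒜} {X : ℕ → Ω → 𝒜} (hX : IsSource μ P Θ X)
    {F : stdSimplex ℝ 𝒜 → unitInterval → 𝒜} (hF : Measurable (Function.uncurry F))
    (hFk : ∀ x, Measure.map (F x) volume = symbolKernel x) :
    P.map (fun ω t => nodeParam Θ X t ω) =
      (sampleLaw 𝒜 (μ : Measure (stdSimplex ℝ 𝒜))).map
        fun ω t => ω.2 (node (symbols F ω) t) := by
  have hm1 : Measurable fun ω t => nodeParam Θ X t ω :=
    measurable_pi_lambda _ (measurable_nodeParam hX.measurable_param hX.measurable_symbol)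
  have hm2 : Measurable fun (ω : Sample 𝒜 (stdSimplex ℝ 𝒜)) t => ω.2 (node (symbols F ω) t) :=
    measurable_pi_lambda _ (measurable_param_node hF)
  have : IsProbabilityMeasure ((sampleLaw 𝒜 (μ : Measure (stdSimplex ℝ 𝒜))).map
      fun ω t => ω.2 (node (symbols F ω) t)) := Measure.isProbabilityMeasure_map hm2.aemeasurable
  -- The law of a sequence is determined by its finite-dimensional marginals; the times in `I` lie
  -- among the first `I.sup id + 1`.
  refine IsProjectiveLimit.unique (P := fun I => ((sampleLaw 𝒜 (μ : Measure (stdSimplex ℝ 𝒜))).map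
      fun ω t => ω.2 (node (symbols F ω) t)).map I.restrict) (fun I => ?_) fun I => rfl
  have hr : Measurable (I.restrict (π := fun _ : ℕ => stdSimplex ℝ 𝒜)) :=
    Finset.measurable_restrict I
  ext S hS
  have hlt : ∀ i : I, (i : ℕ) < I.sup id + 1 := fun i =>
    Nat.lt_succ_of_le (Finset.le_sup (f := id) i.2)
  have hsel : Measurable fun (b : Fin (I.sup id + 1) → stdSimplex ℝ 𝒜) (i : I) => b ⟨i, hlt i⟩ :=
    measurable_pi_lambda _ fun i => measurable_pi_apply _
  have h := hX.lintegral_nodeParam_eq hF hFk (I.sup id + 1)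
    (G := ((fun b (i : I) => b ⟨i, hlt i⟩) ⁻¹' S).indicator 1) (measurable_one.indicator (hsel hS))
  beta_reduce
  rw [Measure.map_map hr hm1, Measure.map_map hr hm2, Measure.map_apply (hr.comp hm1) hS,
    Measure.map_apply (hr.comp hm2) hS, ← lintegral_indicator_one (hr.comp hm1 hS),
    ← lintegral_indicator_one (hr.comp hm2 hS)]
  exact h

end Simplex

/-! ### Empirical measures and weak convergence -/

lemma integral_empiricalMeasure {M : Type*} [MeasurableSpace M] (b : ℕ → M) (n : ℕ) {f : M → ℝ}
    (hf : Measurable f) :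
    ∫ x, f x ∂(empiricalMeasure b n : Measure M) =
      (n : ℝ)⁻¹ * ∑ t ∈ Finset.range n, f (b t) := by
  have hd : ∀ x, ((diracProba x).toFiniteMeasure : Measure M) = Measure.dirac x := fun _ => rfl
  rw [empiricalMeasure, FiniteMeasure.toMeasure_smul, integral_smul_nnreal_measure,
    FiniteMeasure.toMeasure_sum, integral_finsetSum_measure]
  · simp only [hd, integral_dirac' _ _ hf.stronglyMeasurable]
    simp [NNReal.smul_def]
  · intro t _
    rw [hd]
    exact integrable_dirac' hf.stronglyMeasurable enorm_lt_top

lemma abs_average_le {M : Type*} (b : ℕ → M) (n : ℕ) {f : M → ℝ} {C : ℝ} (hC : 0 ≤ C)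
    (hf : ∀ x, |f x| ≤ C) : |(n : ℝ)⁻¹ * ∑ t ∈ Finset.range n, f (b t)| ≤ C := by
  rcases Nat.eq_zero_or_pos n with rfl | hn
  · simpa using hC
  · have hn' : (0 : ℝ) < n := by exact_mod_cast hn
    rw [abs_mul, abs_of_pos (inv_pos.2 hn'), inv_mul_le_iff₀ hn']
    refine (Finset.abs_sum_le_sum_abs _ _).trans ?_
    exact (Finset.sum_le_card_nsmul _ _ C fun t _ => hf _).trans (by simp)

/-- Weak convergence to a measure on a compact metrizable space can be checked on a countable dense
family of continuous functions. -/
lemma tendsto_empiricalMeasure_of_dense {M : Type*} [TopologicalSpace M] [CompactSpace M]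
    [SecondCountableTopology M] [MeasurableSpace M] [BorelSpace M] (μ : ProbabilityMeasure M)
    (b : ℕ → M) {u : ℕ → C(M, ℝ)} (hu : DenseRange u)
    (h : ∀ k, Tendsto (fun n : ℕ => (n : ℝ)⁻¹ * ∑ t ∈ Finset.range n, u k (b t)) atTop
      (𝓝 (∫ x, u k x ∂(μ : Measure M)))) :
    Tendsto (fun n : ℕ => empiricalMeasure b n) atTop (𝓝 μ.toFiniteMeasure) := by
  rw [FiniteMeasure.tendsto_iff_forall_integral_tendsto]
  intro f
  change Tendsto _ _ (𝓝 (∫ x, f x ∂(μ : Measure M)))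
  simp only [integral_empiricalMeasure b _ f.continuous.measurable]
  rw [Metric.tendsto_atTop]
  intro ε hε
  obtain ⟨k, hk⟩ := hu.exists_dist_lt f.toContinuousMap (show 0 < ε / 3 by positivity)
  have hfk : ∀ x, |f x - u k x| ≤ ε / 3 := fun x =>
    (Real.dist_eq (f x) (u k x)) ▸ (ContinuousMap.dist_apply_le_dist x).trans hk.le
  obtain ⟨N, hN⟩ := Metric.tendsto_atTop.1 (h k) (ε / 3) (by positivity)
  refine ⟨N, fun n hn => ?_⟩
  have h1 := hN n hn
  have h2 := abs_average_le b n (f := fun x => f x - u k x) (by positivity) hfk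
  rw [Finset.sum_sub_distrib, mul_sub] at h2
  have hfi : Integrable f (μ : Measure M) := f.integrable _
  have hui : Integrable (u k) (μ : Measure M) :=
    (BoundedContinuousFunction.mkOfCompact (u k)).integrable _
  have h3 : |∫ x, f x ∂(μ : Measure M) - ∫ x, u k x ∂(μ : Measure M)| ≤ ε / 3 := by
    rw [← integral_sub hfi hui]
    refine (norm_integral_le_of_norm_le_const (μ := (μ : Measure M))
      (f := fun x => f x - u k x) (C := ε / 3) (ae_of_all _ hfk)).trans ?_
    simp
  rw [Real.dist_eq] at h1 ⊢
  rw [abs_lt] at h1 ⊢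
  rw [abs_le] at h2 h3
  constructor <;> linarith [h1.1, h1.2, h2.1, h2.2, h3.1, h3.2]

/-! ### Transfer to an arbitrary source -/

variable {𝒜 : Type*} [Fintype 𝒜] [DecidableEq 𝒜] [MeasurableSpace 𝒜] [MeasurableSingletonClass 𝒜]

/-- Convergence of the averages is a measurable property of the parameter sequence alone, so it
passes between processes in which that sequence has the same law. -/
lemma IsSource.ae_tendsto_average_of_centred {μ : ProbabilityMeasure (stdSimplex ℝ 𝒜)} {Ω : Type*}
    [MeasurableSpace Ω] {P : Measure Ω} [IsProbabilityMeasure P] {Θ : ℕ → Ω → stdSimplex ℝ 𝒜}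
    {X : ℕ → Ω → 𝒜} (hX : IsSource μ P Θ X) {f : stdSimplex ℝ 𝒜 → ℝ} (hf : Measurable f)
    (hb : ∀ x, |f x| ≤ 1) (h0 : ∫ x, f x ∂(μ : Measure (stdSimplex ℝ 𝒜)) = 0) :
    ∀ᵐ ω ∂P, Tendsto
      (fun n : ℕ => (n : ℝ)⁻¹ * ∑ t ∈ Finset.range n, f (nodeParam Θ X t ω)) atTop (𝓝 0) := by
  have hn' : Nonempty 𝒜 := by
    obtain ⟨θ⟩ := nonempty_of_isProbabilityMeasure (μ : Measure (stdSimplex ℝ 𝒜))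
    by_contra h
    rw [not_nonempty_iff] at h
    have := stdSimplex.sum_eq_one θ
    rw [Fintype.sum_empty] at this
    exact zero_ne_one this
  obtain ⟨F, hF, hFk⟩ := Kernel.exists_measurable_map_eq_unitInterval (symbolKernel (𝒜 := 𝒜))
  have hm : MeasurableSet {b : ℕ → stdSimplex ℝ 𝒜 | Tendsto
      (fun n : ℕ => (n : ℝ)⁻¹ * ∑ t ∈ Finset.range n, f (b t)) atTop (𝓝 0)} :=
    measurableSet_tendsto _ fun n => (Finset.measurable_sum _ fun t _ =>
      hf.comp (measurable_pi_apply t)).const_mul _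
  have h1 : Measurable fun ω t => nodeParam Θ X t ω :=
    measurable_pi_lambda _ (measurable_nodeParam hX.measurable_param hX.measurable_symbol)
  have h2 : Measurable fun (ω : Sample 𝒜 (stdSimplex ℝ 𝒜)) t => ω.2 (node (symbols F ω) t) :=
    measurable_pi_lambda _ (measurable_param_node hF)
  refine (ae_map_iff h1.aemeasurable hm).1 ?_
  rw [hX.map_nodeParam_eq hF hFk, ae_map_iff h2.aemeasurable hm]
  exact ae_tendsto_average_node hF _ hf hb h0

/-- The strong law of large numbers for the parameters along an LZ78 source. -/
lemma IsSource.ae_tendsto_average {μ : ProbabilityMeasure (stdSimplex ℝ 𝒜)} {Ω : Type*}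
    [MeasurableSpace Ω] {P : Measure Ω} [IsProbabilityMeasure P] {Θ : ℕ → Ω → stdSimplex ℝ 𝒜}
    {X : ℕ → Ω → 𝒜} (hX : IsSource μ P Θ X) {f : stdSimplex ℝ 𝒜 → ℝ} (hf : Measurable f) {C : ℝ}
    (hC : ∀ x, |f x| ≤ C) :
    ∀ᵐ ω ∂P, Tendsto (fun n : ℕ => (n : ℝ)⁻¹ * ∑ t ∈ Finset.range n, f (nodeParam Θ X t ω))
      atTop (𝓝 (∫ x, f x ∂(μ : Measure (stdSimplex ℝ 𝒜)))) := by
  set I := ∫ x, f x ∂(μ : Measure (stdSimplex ℝ 𝒜))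
  have hfi : Integrable f (μ : Measure (stdSimplex ℝ 𝒜)) :=
    Integrable.of_bound hf.aestronglyMeasurable C (ae_of_all _ hC)
  have hI : |I| ≤ C := by
    refine (norm_integral_le_of_norm_le_const (μ := (μ : Measure (stdSimplex ℝ 𝒜)))
      (f := f) (C := C) (ae_of_all _ hC)).trans ?_
    simp
  have hC0 : 0 ≤ C := (abs_nonneg I).trans hI
  -- Since `|f - I| ≤ 2 * C`, dividing by `2 * C + 1` normalises the centred function; the `1`
  -- covers `C = 0`.
  have hK : 0 < 2 * C + 1 := by positivity
  have h := hX.ae_tendsto_average_of_centred (f := fun x => (2 * C + 1)⁻¹ * (f x - I))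
    ((hf.sub_const I).const_mul _) (fun x => ?_) ?_
  · filter_upwards [h] with ω hω
    have h1 := (hω.const_mul (2 * C + 1)).add_const I
    rw [mul_zero, zero_add] at h1
    refine h1.congr' ?_
    filter_upwards [eventually_gt_atTop 0] with n hn
    have hn' : (n : ℝ) ≠ 0 := by positivity
    rw [← Finset.mul_sum, Finset.sum_sub_distrib, Finset.sum_const, Finset.card_range, nsmul_eq_mul]
    field_simp
    ring
  · rw [abs_mul, abs_of_pos (inv_pos.2 hK), inv_mul_le_iff₀ hK]
    have := abs_sub (f x) I
    linarith [hC x]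
  · rw [integral_const_mul, integral_sub hfi (integrable_const I)]
    simp [I]

end LZ78

theorem mainTheorem2 {𝒜 : Type*} [Fintype 𝒜] [DecidableEq 𝒜] [MeasurableSpace 𝒜]
    [MeasurableSingletonClass 𝒜] (μ : ProbabilityMeasure (stdSimplex ℝ 𝒜))
    {Ω : Type*} [MeasurableSpace Ω] (P : Measure Ω) [IsProbabilityMeasure P]
    (Θ : ℕ → Ω → stdSimplex ℝ 𝒜) (X : ℕ → Ω → 𝒜) (hX : LZ78.IsSource μ P Θ X) :
    (∀ᵐ ω ∂P, Tendsto
        (fun n : ℕ => LZ78.empiricalMeasure (fun t => LZ78.nodeParam Θ X t ω) n)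
        atTop (𝓝 μ.toFiniteMeasure)) ∧
    (∀ A : Set (stdSimplex ℝ 𝒜), MeasurableSet A →
      ∀ᵐ ω ∂P, Tendsto
        (fun n : ℕ => LZ78.empiricalMeasure (fun t => LZ78.nodeParam Θ X t ω) n A)
        atTop (𝓝 (μ A))) := by
  constructor
  -- The simplex is compact metrizable, so countably many continuous test functions are dense and
  -- one null set serves them all.
  · have hall : ∀ k : ℕ, ∀ᵐ ω ∂P, Tendsto (fun n : ℕ => (n : ℝ)⁻¹ * ∑ t ∈ Finset.range n,
        TopologicalSpace.denseSeq C(stdSimplex ℝ 𝒜, ℝ) k (LZ78.nodeParam Θ X t ω)) atTop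
        (𝓝 (∫ x, TopologicalSpace.denseSeq C(stdSimplex ℝ 𝒜, ℝ) k x
          ∂(μ : Measure (stdSimplex ℝ 𝒜)))) := fun k =>
      hX.ae_tendsto_average (C := ‖TopologicalSpace.denseSeq C(stdSimplex ℝ 𝒜, ℝ) k‖)
        (TopologicalSpace.denseSeq C(stdSimplex ℝ 𝒜, ℝ) k).continuous.measurable
        fun x => ContinuousMap.norm_coe_le_norm (TopologicalSpace.denseSeq C(stdSimplex ℝ 𝒜, ℝ) k) x
    filter_upwards [ae_all_iff.2 hall] with ω hω
    exact LZ78.tendsto_empiricalMeasure_of_dense μ _ (TopologicalSpace.denseRange_denseSeq _) hω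
  · intro A hA
    have hm : Measurable (A.indicator (1 : stdSimplex ℝ 𝒜 → ℝ)) := measurable_one.indicator hA
    have hb : ∀ x, |A.indicator (1 : stdSimplex ℝ 𝒜 → ℝ) x| ≤ 1 := by
      intro x
      by_cases hx : x ∈ A <;> simp [hx]
    filter_upwards [hX.ae_tendsto_average hm hb] with ω hω
    rw [← NNReal.tendsto_coe]
    rw [integral_indicator_one hA] at hω
    refine hω.congr fun n => ?_
    rw [← LZ78.integral_empiricalMeasure (fun t => LZ78.nodeParam Θ X t ω) n hm,
      integral_indicator_one hA]
    rfl
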